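/- Let $(X,d,\mu)$ be a complete separable metric space with a non-negative Radon (locally finite Borel) measure $\mu$, let $\Omega\subset X$ be open, $\tau>0$, $p\in[1,\infty)$ and $\Omega_\tau:=\Omega\times(0,\tau)$. No doubling condition or Poincaré inequality is assumed. Write $A\Subset B$ if $A\subset B$ is bounded and $\operatorname{dist}(A,B^c)>0$. For an open $U\subset X$, a Borel $g:U\to[0,\infty]$ is a $p$-weak upper gradient of $u:U\to\mathbb R$ if $|u(\gamma_1)-u(\gamma_0)|\le\int_\gamma g\,ds$ for all absolutely continuous curves $\gamma:[0,1]\to U$ outside a family of zero $p$-modulus; it is the minimal one, denoted $g_u$, if it is $p$-integrable and $g\le h$ $\mu$-a.e. for every $p$-integrable $p$-weak upper gradient $h$ of $u$. $N^{1,p}(U)$ is the space of $u\in L^p(U)$ having a $p$-integrable $p$-weak upper gradient, with norm $\left(\|u\|_{L^p(U)}^p+\|g_u\|_{L^p(U)}^p\right)^{1/p}$, modulo functions of zero norm. $u\in N^{1,p}_{\rm loc}(\Omega)$ means that $u\in N^{1,p}(U)$ for every open $U\Subset\Omega$; then $g_u$ denotes the function on $\Omega$ that is the minimal $p$-weak upper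 gradient of $u$ on every such $U$. $f\in L^p_{\rm loc}(0,\tau;N^{1,p}_{\rm loc}(\Omega))$ means that $f(t)\in N^{1,p}_{\rm loc}(\Omega)$ for a.e. $t\in(0,\tau)$ and that, for every open $U\Subset\Omega$ and every $[a,b]\subset(0,\tau)$, the map $t\mapsto f(t)$ is strongly measurable from $[a,b]$ to $N^{1,p}(U)$ with $\int_a^b\|f(t)\|_{N^{1,p}(U)}^p\,dt<\infty$. For a time-dependent function $h$ with $h(t)\in N^{1,p}_{\rm loc}(\Omega)$ for a.e. $t$, $g_h$ is a measurable function of $(x,t)$ with $g_h(\cdot,t)=g_{h(t)}$ for a.e. $t$. Let $\eta\in C^\infty(\mathbb R)$ be non-negative, supported in $[-1,1]$, with $\int\eta=1$, and let $\eta_\varepsilon(s)=\varepsilon^{-1}\eta(s/\varepsilon)$, $\varepsilon>0$. For $f\in L^p_{\rm loc}(0,\tau;N^{1,p}_{\rm loc}(\Omega))$ let $$f_\varepsilon(t)=\int_{-\varepsilon}^{\varepsilon}\eta_\varepsilon(s)f(t-s)\,ds,\qquad t\in(\varepsilon,\tau-\varepsilon),$$ be its time mollification, that is, the element of $N^{1,p}_{\rm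 loc}(\Omega)$ given in each $N^{1,p}(U)$, $U\Subset\Omega$ open, by this Bochner integral. Then $f_\varepsilon$ and the functions $g_{f_\varepsilon-f}$ (for times in $(\varepsilon,\tau-\varepsilon)$) and $g_{f(\cdot-s)-f}$ (for times $t$ with $t,t-s\in(0,\tau)$) exist, and: 1. $g_{f_\varepsilon-f}\to0$ in $L^p_{\rm loc}(\Omega_\tau)$ as $\varepsilon\to0^+$, that is, $\|g_{f_\varepsilon-f}\|_{L^p(K)}\to0$ for every $K\Subset\Omega_\tau$. 2. $g_{f(\cdot-s)-f}\to0$ in $L^p_{\rm loc}(\Omega_\tau)$ as $s\to0$, uniformly in the time range: for every $K\Subset\Omega_\tau$ and $\delta>0$ there is $\sigma>0$ such that $\|g_{f(\cdot-s)-f}\|_{L^p(K\cap(X\times J))}\le\delta$ for all $|s|<\sigma$ and all sets of times $J\subset\mathbb R$. -/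

import Mathlib

open MeasureTheory Filter Topology Set
open scoped ENNReal

noncomputable section

namespace NewtonSobolev

/-- `A ⋐ B`: `A` is a bounded subset of `B` at positive distance from the complement of `B`
(the distance to an empty complement being `+∞`). -/
def WellInside {Y : Type*} [PseudoMetricSpace Y] (A B : Set Y) : Prop :=
  A ⊆ B ∧ Bornology.IsBounded A ∧ ∃ r : ℝ, 0 < r ∧ ∀ x ∈ A, ∀ y ∉ B, r ≤ dist x y

variable {X : Type*} [MetricSpace X]

/-- Absolutely continuous curves `γ : [0,1] → U` (values of `γ` off `[0,1]` are irrelevant). -/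
def IsACCurve (U : Set X) (γ : ℝ → X) : Prop :=
  AbsolutelyContinuousOnInterval γ 0 1 ∧ ∀ t ∈ Icc (0 : ℝ) 1, γ t ∈ U

/-- The metric derivative `|γ'|(t) = lim_{h → 0} d(γ(t+h), γ(t)) / |h|`; for an absolutely
continuous curve the limit exists almost everywhere, elsewhere the upper limit is used. -/
def metricSpeed (γ : ℝ → X) (t : ℝ) : ℝ≥0∞ :=
  limsup (fun h : ℝ => edist (γ (t + h)) (γ t) / ENNReal.ofReal |h|) (𝓝[≠] 0)

/-- The path integral `∫_γ ρ ds = ∫₀¹ ρ(γ(t)) |γ'|(t) dt`. -/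
def curveIntegral (ρ : X → ℝ≥0∞) (γ : ℝ → X) : ℝ≥0∞ :=
  ∫⁻ t in Icc (0 : ℝ) 1, ρ (γ t) * metricSpeed γ t

variable [MeasurableSpace X]

/-- The `p`-modulus, in the metric measure space `(U, d, μ⌞U)`, of a family `Γ` of curves. -/
def modulus (p : ℝ) (μ : Measure X) (U : Set X) (Γ : Set (ℝ → X)) : ℝ≥0∞ :=
  ⨅ (ρ : X → ℝ≥0∞) (_ : Measurable ρ) (_ : ∀ γ ∈ Γ, 1 ≤ curveIntegral ρ γ),
    ∫⁻ x in U, ρ x ^ p ∂μ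

/-- The absolutely continuous curves in `U` along which the upper gradient inequality
`|u(γ(1)) - u(γ(0))| ≤ ∫_γ g ds` fails. -/
def badCurves (U : Set X) (u : X → ℝ) (g : X → ℝ≥0∞) : Set (ℝ → X) :=
  {γ | IsACCurve U γ ∧ ¬ ENNReal.ofReal |u (γ 1) - u (γ 0)| ≤ curveIntegral g γ}

/-- `g` is a `p`-weak upper gradient of `u` in `U`. -/
def IsWeakUpperGradient (p : ℝ) (μ : Measure X) (U : Set X) (u : X → ℝ) (g : X → ℝ≥0∞) : Prop :=
  Measurable g ∧ modulus p μ U (badCurves U u g) = 0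

/-- `g` is a minimal `p`-weak upper gradient of `u` in `U`. -/
def IsMinWeakUpperGradient (p : ℝ) (μ : Measure X) (U : Set X) (u : X → ℝ) (g : X → ℝ≥0∞) :
    Prop :=
  IsWeakUpperGradient p μ U u g ∧ ∫⁻ x in U, g x ^ p ∂μ < ∞ ∧
    ∀ h : X → ℝ≥0∞, IsWeakUpperGradient p μ U u h → ∫⁻ x in U, h x ^ p ∂μ < ∞ →
      ∀ᵐ x ∂(μ.restrict U), g x ≤ h x

/-- The Dirichlet seminorm: the least `L^p(U)` norm of a `p`-weak upper gradient of `u` in `U`. -/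
def gradNorm (p : ℝ) (μ : Measure X) (U : Set X) (u : X → ℝ) : ℝ≥0∞ :=
  ⨅ (g : X → ℝ≥0∞) (_ : IsWeakUpperGradient p μ U u g), eLpNorm g (ENNReal.ofReal p) (μ.restrict U)

/-- `u|_U` is a `p`-integrable function with a `p`-integrable `p`-weak upper gradient in `U`. -/
def MemNewton (p : ℝ) (μ : Measure X) (U : Set X) (u : X → ℝ) : Prop :=
  MemLp u (ENNReal.ofReal p) (μ.restrict U) ∧
    ∃ g : X → ℝ≥0∞, IsWeakUpperGradient p μ U u g ∧ ∫⁻ x in U, g x ^ p ∂μ < ∞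

/-- `(‖u‖_{L^p(U)}^p + ‖g_u‖_{L^p(U)}^p)^{1/p}`. -/
def newtonENorm (p : ℝ) (μ : Measure X) (U : Set X) (u : X → ℝ) : ℝ≥0∞ :=
  (eLpNorm u (ENNReal.ofReal p) (μ.restrict U) ^ p + gradNorm p μ U u ^ p) ^ (1 / p)

section basic

variable {p : ℝ} {μ : Measure X} {U : Set X}

lemma curveIntegral_mono {ρ σ : X → ℝ≥0∞} (h : ∀ x, ρ x ≤ σ x) (γ : ℝ → X) :
    curveIntegral ρ γ ≤ curveIntegral σ γ :=
  lintegral_mono fun t => mul_le_mul_left (h (γ t)) _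

lemma modulus_mono {Γ Γ' : Set (ℝ → X)} (h : Γ ⊆ Γ') : modulus p μ U Γ ≤ modulus p μ U Γ' := by
  refine le_iInf fun ρ => le_iInf fun hρ => le_iInf fun h1 => ?_
  exact iInf_le_of_le ρ (iInf_le_of_le hρ (iInf_le_of_le (fun γ hγ => h1 γ (h hγ)) le_rfl))

lemma modulus_union_le (hp : 1 ≤ p) (Γ Γ' : Set (ℝ → X)) :
    modulus p μ U (Γ ∪ Γ') ≤ modulus p μ U Γ + modulus p μ U Γ' := by
  unfold modulus
  simp only [ENNReal.iInf_add, ENNReal.add_iInf]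
  refine le_iInf fun ρ => le_iInf fun hρ => le_iInf fun h1 => ?_
  refine le_iInf fun σ => le_iInf fun hσ => le_iInf fun h2 => ?_
  refine iInf_le_of_le (fun x => max (σ x) (ρ x)) (iInf_le_of_le (hσ.max hρ) (iInf_le_of_le ?_ ?_))
  · rintro γ (hγ | hγ)
    · first
      | exact (h1 γ hγ).trans (curveIntegral_mono (fun x => le_max_right _ _) γ)
      | exact (h2 γ hγ).trans (curveIntegral_mono (fun x => le_max_left _ _) γ)
    · first
      | exact (h2 γ hγ).trans (curveIntegral_mono (fun x => le_max_left _ _) γ)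
      | exact (h1 γ hγ).trans (curveIntegral_mono (fun x => le_max_right _ _) γ)
  · rw [← lintegral_add_left (by fun_prop)]
    refine lintegral_mono fun x => ?_
    rcases le_total (σ x) (ρ x) with h | h
    · simp [max_eq_right h]
    · simp [max_eq_left h]

lemma IsWeakUpperGradient.add (hp : 1 ≤ p) {u v : X → ℝ} {g h : X → ℝ≥0∞}
    (hu : IsWeakUpperGradient p μ U u g) (hv : IsWeakUpperGradient p μ U v h) :
    IsWeakUpperGradient p μ U (u + v) (g + h) := by
  refine ⟨hu.1.add hv.1, le_antisymm ?_ bot_le⟩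
  have hsub : badCurves U (u + v) (g + h) ⊆ badCurves U u g ∪ badCurves U v h := by
    rintro γ ⟨hγ, hb⟩
    by_contra hcon
    simp only [badCurves, mem_union, mem_ofPred_eq, hγ, true_and, not_or, not_not] at hcon
    apply hb
    have e : (u + v) (γ 1) - (u + v) (γ 0) = (u (γ 1) - u (γ 0)) + (v (γ 1) - v (γ 0)) := by
      simp only [Pi.add_apply]; ring
    rw [e]
    calc _ ≤ ENNReal.ofReal (|u (γ 1) - u (γ 0)| + |v (γ 1) - v (γ 0)|) :=
          ENNReal.ofReal_le_ofReal (abs_add_le _ _)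
      _ = _ := ENNReal.ofReal_add (abs_nonneg _) (abs_nonneg _)
      _ ≤ _ := add_le_add hcon.1 hcon.2
      _ ≤ _ := by
          refine (le_lintegral_add _ _).trans (le_of_eq ?_)
          simp only [curveIntegral, Pi.add_apply, add_mul]
  calc _ ≤ _ := modulus_mono hsub
    _ ≤ _ := modulus_union_le hp _ _
    _ = 0 := by rw [hu.2, hv.2, add_zero]

lemma IsWeakUpperGradient.smul (c : ℝ) {u : X → ℝ} {g : X → ℝ≥0∞}
    (hu : IsWeakUpperGradient p μ U u g) :
    IsWeakUpperGradient p μ U (c • u) (fun x => ENNReal.ofReal |c| * g x) := by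
  refine ⟨hu.1.const_mul _, le_antisymm ?_ bot_le⟩
  rw [← hu.2]
  refine modulus_mono ?_
  rintro γ ⟨hγ, hb⟩
  refine ⟨hγ, fun h => hb ?_⟩
  have e : (c • u) (γ 1) - (c • u) (γ 0) = c * (u (γ 1) - u (γ 0)) := by
    simp only [Pi.smul_apply, smul_eq_mul]; ring
  rw [e, abs_mul, ENNReal.ofReal_mul (abs_nonneg _)]
  simp only [curveIntegral, mul_assoc]
  rw [lintegral_const_mul' _ _ ENNReal.ofReal_ne_top]
  exact mul_le_mul_right h _

lemma isWeakUpperGradient_zero (hp : 1 ≤ p) : IsWeakUpperGradient p μ U (0 : X → ℝ) 0 := by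
  refine ⟨measurable_const, le_antisymm ?_ bot_le⟩
  refine iInf_le_of_le 0 (iInf_le_of_le measurable_const (iInf_le_of_le ?_ ?_))
  · rintro γ ⟨-, h⟩
    simp at h
  · simp [ENNReal.zero_rpow_of_pos (zero_lt_one.trans_le hp)]

lemma eLpNorm_lt_top_iff_lintegral (hp : 1 ≤ p) (g : X → ℝ≥0∞) :
    eLpNorm g (ENNReal.ofReal p) (μ.restrict U) < ∞ ↔ ∫⁻ x in U, g x ^ p ∂μ < ∞ := by
  have hp0 : 0 < p := zero_lt_one.trans_le hp
  rw [eLpNorm_lt_top_iff_lintegral_rpow_enorm_lt_top (by simpa using hp0) ENNReal.ofReal_ne_top,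
    ENNReal.toReal_ofReal hp0.le]
  simp

lemma gradNorm_lt_top_iff (hp : 1 ≤ p) (u : X → ℝ) : gradNorm p μ U u < ∞ ↔
    ∃ g : X → ℝ≥0∞, IsWeakUpperGradient p μ U u g ∧ ∫⁻ x in U, g x ^ p ∂μ < ∞ := by
  simp only [gradNorm, iInf_lt_iff, exists_prop, eLpNorm_lt_top_iff_lintegral hp]

lemma gradNorm_add_le (hp : 1 ≤ p) (u v : X → ℝ) :
    gradNorm p μ U (u + v) ≤ gradNorm p μ U u + gradNorm p μ U v := by
  conv_rhs => unfold gradNorm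
  simp only [ENNReal.iInf_add, ENNReal.add_iInf]
  refine le_iInf fun g => le_iInf fun hg => le_iInf fun h => le_iInf fun hh => ?_
  first
  | exact (iInf₂_le _ (hg.add hp hh)).trans (eLpNorm_add_le hg.1.aestronglyMeasurable
      hh.1.aestronglyMeasurable (by simpa using hp))
  | (rw [add_comm u v, add_comm (eLpNorm _ _ _)]
     exact (iInf₂_le _ (hg.add hp hh)).trans (eLpNorm_add_le hg.1.aestronglyMeasurable
      hh.1.aestronglyMeasurable (by simpa using hp)))

lemma gradNorm_smul_le (hp : 1 ≤ p) (c : ℝ) (u : X → ℝ) :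
    gradNorm p μ U (c • u) ≤ ENNReal.ofReal |c| * gradNorm p μ U u := by
  have hp0 : 0 < p := zero_lt_one.trans_le hp
  rcases eq_or_ne c 0 with rfl | hc
  · rw [zero_smul]
    refine (iInf₂_le _ (isWeakUpperGradient_zero hp)).trans ?_
    rw [eLpNorm_zero]
    exact bot_le
  · have hc0 : ENNReal.ofReal |c| ≠ 0 := by simpa using hc
    conv_rhs => unfold gradNorm
    simp only [ENNReal.mul_iInf_of_ne hc0 ENNReal.ofReal_ne_top]
    refine le_iInf fun g => le_iInf fun hg => (iInf₂_le _ (hg.smul c)).trans ?_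
    have hq0 : ENNReal.ofReal p ≠ 0 := by simpa using hp0
    rw [eLpNorm_eq_lintegral_rpow_enorm_toReal hq0 ENNReal.ofReal_ne_top,
      eLpNorm_eq_lintegral_rpow_enorm_toReal hq0 ENNReal.ofReal_ne_top,
      ENNReal.toReal_ofReal hp0.le]
    simp only [enorm_eq_self, ENNReal.mul_rpow_of_nonneg _ _ hp0.le]
    rw [lintegral_const_mul' _ _ (ENNReal.rpow_ne_top_of_nonneg hp0.le ENNReal.ofReal_ne_top),
      ENNReal.mul_rpow_of_nonneg _ _ (by positivity), ← ENNReal.rpow_mul,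
      mul_one_div_cancel hp0.ne', ENNReal.rpow_one]

lemma newtonENorm_add_le (hp : 1 ≤ p) {u v : X → ℝ} (hu : MemNewton p μ U u)
    (hv : MemNewton p μ U v) :
    newtonENorm p μ U (u + v) ≤ newtonENorm p μ U u + newtonENorm p μ U v := by
  have hp0 : 0 < p := zero_lt_one.trans_le hp
  have key := ENNReal.Lp_add_le (Finset.univ : Finset (Fin 2))
    ![eLpNorm u (ENNReal.ofReal p) (μ.restrict U), gradNorm p μ U u]
    ![eLpNorm v (ENNReal.ofReal p) (μ.restrict U), gradNorm p μ U v] hp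
  simp only [Fin.sum_univ_two, Matrix.cons_val_zero, Matrix.cons_val_one] at key
  refine le_trans ?_ key
  unfold newtonENorm
  gcongr
  · exact eLpNorm_add_le hu.1.1 hv.1.1 (by simpa using hp)
  · exact gradNorm_add_le hp u v

lemma newtonENorm_smul_le (hp : 1 ≤ p) (c : ℝ) (u : X → ℝ) :
    newtonENorm p μ U (c • u) ≤ ENNReal.ofReal |c| * newtonENorm p μ U u := by
  have hp0 : 0 < p := zero_lt_one.trans_le hp
  have h1 : eLpNorm (c • u) (ENNReal.ofReal p) (μ.restrict U) =
      ENNReal.ofReal |c| * eLpNorm u (ENNReal.ofReal p) (μ.restrict U) := by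
    rw [eLpNorm_const_smul, ← ofReal_norm, Real.norm_eq_abs]
  calc newtonENorm p μ U (c • u)
      ≤ ((ENNReal.ofReal |c| * eLpNorm u (ENNReal.ofReal p) (μ.restrict U)) ^ p +
          (ENNReal.ofReal |c| * gradNorm p μ U u) ^ p) ^ (1 / p) := by
        unfold newtonENorm
        rw [h1]
        gcongr
        exact gradNorm_smul_le hp c u
    _ = _ := by
        rw [ENNReal.mul_rpow_of_nonneg _ _ hp0.le, ENNReal.mul_rpow_of_nonneg _ _ hp0.le,
          ← mul_add, ENNReal.mul_rpow_of_nonneg _ _ (by positivity), ← ENNReal.rpow_mul,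
          mul_one_div_cancel hp0.ne', ENNReal.rpow_one]
        rfl

lemma MemNewton.newtonENorm_ne_top (hp : 1 ≤ p) {u : X → ℝ} (hu : MemNewton p μ U u) :
    newtonENorm p μ U u ≠ ∞ := by
  have hp0 : 0 < p := zero_lt_one.trans_le hp
  refine ENNReal.rpow_ne_top_of_nonneg (by positivity) (ENNReal.add_ne_top.2 ⟨?_, ?_⟩)
  · exact ENNReal.rpow_ne_top_of_nonneg hp0.le hu.1.2.ne
  · exact ENNReal.rpow_ne_top_of_nonneg hp0.le ((gradNorm_lt_top_iff hp u).2 hu.2).ne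

lemma MemNewton.add (hp : 1 ≤ p) {u v : X → ℝ} (hu : MemNewton p μ U u)
    (hv : MemNewton p μ U v) : MemNewton p μ U (u + v) := by
  refine ⟨hu.1.add hv.1, (gradNorm_lt_top_iff hp _).1 ((gradNorm_add_le hp u v).trans_lt ?_)⟩
  exact ENNReal.add_lt_top.2 ⟨(gradNorm_lt_top_iff hp u).2 hu.2, (gradNorm_lt_top_iff hp v).2 hv.2⟩

lemma MemNewton.smul (hp : 1 ≤ p) (c : ℝ) {u : X → ℝ} (hu : MemNewton p μ U u) :
    MemNewton p μ U (c • u) := by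
  refine ⟨hu.1.const_smul c, (gradNorm_lt_top_iff hp _).1 ((gradNorm_smul_le hp c u).trans_lt ?_)⟩
  exact ENNReal.mul_lt_top ENNReal.ofReal_lt_top ((gradNorm_lt_top_iff hp u).2 hu.2)

lemma memNewton_zero (hp : 1 ≤ p) : MemNewton p μ U (0 : X → ℝ) :=
  ⟨MemLp.zero, 0, isWeakUpperGradient_zero hp, by
    simp [ENNReal.zero_rpow_of_pos (zero_lt_one.trans_le hp)]⟩

end basic

/-- The vector space of functions underlying `N^{1,p}(U)`, before passing to the quotient.
Functions are defined on all of `X`, but only their values on `U` enter. -/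
def preNewtonSubmodule (p : ℝ) [hp : Fact (1 ≤ p)] (μ : Measure X) (U : Set X) :
    Submodule ℝ (X → ℝ) where
  carrier := {u | MemNewton p μ U u}
  add_mem' hu hv := MemNewton.add hp.out hu hv
  zero_mem' := memNewton_zero hp.out
  smul_mem' c _ hu := MemNewton.smul hp.out c hu

/-- `Ñ^{1,p}(U)`, to be equipped with its seminorm. -/
def PreNewton (p : ℝ) [Fact (1 ≤ p)] (μ : Measure X) (U : Set X) : Type _ :=
  ↥(preNewtonSubmodule p μ U)

section norm

variable (p : ℝ) [hp : Fact (1 ≤ p)] (μ : Measure X) (U : Set X)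

instance : AddCommGroup (PreNewton p μ U) :=
  inferInstanceAs (AddCommGroup ↥(preNewtonSubmodule p μ U))

instance : Module ℝ (PreNewton p μ U) :=
  inferInstanceAs (Module ℝ ↥(preNewtonSubmodule p μ U))

/-- The seminorm of `Ñ^{1,p}(U)`. -/
def newtonSeminorm : Seminorm ℝ (PreNewton p μ U) :=
  Seminorm.ofSMulLE (fun u => (newtonENorm p μ U u.1).toReal)
    (by
      have h := newtonENorm_smul_le (μ := μ) (U := U) hp.out 0 (0 : X → ℝ)
      simp only [zero_smul, abs_zero, ENNReal.ofReal_zero, zero_mul, nonpos_iff_eq_zero] at h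
      change (newtonENorm p μ U (0 : X → ℝ)).toReal = 0
      rw [h, ENNReal.toReal_zero])
    (fun u v => by
      have hu := MemNewton.newtonENorm_ne_top hp.out u.2
      have hv := MemNewton.newtonENorm_ne_top hp.out v.2
      rw [← ENNReal.toReal_add hu hv]
      exact ENNReal.toReal_mono (ENNReal.add_ne_top.2 ⟨hu, hv⟩)
        (newtonENorm_add_le hp.out u.2 v.2))
    (fun c u => by
      have hu := MemNewton.newtonENorm_ne_top hp.out u.2
      have h := ENNReal.toReal_mono (ENNReal.mul_ne_top ENNReal.ofReal_ne_top hu)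
        (newtonENorm_smul_le (μ := μ) (U := U) hp.out c u.1)
      rwa [ENNReal.toReal_mul, ENNReal.toReal_ofReal (abs_nonneg c), ← Real.norm_eq_abs] at h)

instance : SeminormedAddCommGroup (PreNewton p μ U) :=
  (newtonSeminorm p μ U).toAddGroupSeminorm.toSeminormedAddCommGroup

instance : NormedSpace ℝ (PreNewton p μ U) where
  norm_smul_le c u := (map_smul_eq_mul (newtonSeminorm p μ U) c u).le

/-- The Newton-Sobolev space `N^{1,p}(U)`: the quotient of `Ñ^{1,p}(U)` by the functions of zero
seminorm, with the quotient norm. -/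
abbrev Newton : Type _ := SeparationQuotient (PreNewton p μ U)

open Classical in
/-- The class in `N^{1,p}(U)` of a function `u` with `u|_U ∈ Ñ^{1,p}(U)` (and `0` otherwise). -/
def toNewton (u : X → ℝ) : Newton p μ U :=
  if h : MemNewton p μ U u then SeparationQuotient.mk (⟨u, h⟩ : PreNewton p μ U) else 0

end norm

/-- `u ∈ N^{1,p}_loc(Ω)`: `u ∈ N^{1,p}(U)` for all open `U ⋐ Ω`. -/
def MemNewtonLoc (p : ℝ) (μ : Measure X) (Ω : Set X) (u : X → ℝ) : Prop :=
  ∀ U : Set X, IsOpen U → WellInside U Ω → MemNewton p μ U u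

/-- `g` is the minimal `p`-weak upper gradient of `u ∈ N^{1,p}_loc(Ω)`, that is, on every open
`U ⋐ Ω`. -/
def IsMinWeakUpperGradientLoc (p : ℝ) (μ : Measure X) (Ω : Set X) (u : X → ℝ) (g : X → ℝ≥0∞) :
    Prop :=
  ∀ U : Set X, IsOpen U → WellInside U Ω → IsMinWeakUpperGradient p μ U u g

/-- `f ∈ L^p_loc(0,τ; N^{1,p}_loc(Ω))`: for all open `U ⋐ Ω` and `[a,b] ⊂ (0,τ)`, the map
`t ↦ f(t)` is strongly measurable from `[a,b]` to `N^{1,p}(U)`, with `p`-integrable norm. Here `f`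
is given by representatives `f t : X → ℝ`, of which only the values on `Ω` enter. -/
def MemParabolicLoc (p : ℝ) [Fact (1 ≤ p)] (μ : Measure X) (Ω : Set X) (τ : ℝ)
    (f : ℝ → X → ℝ) : Prop :=
  (∀ᵐ t ∂(volume.restrict (Ioo 0 τ)), MemNewtonLoc p μ Ω (f t)) ∧
    ∀ U : Set X, IsOpen U → WellInside U Ω → ∀ a b : ℝ, 0 < a → b < τ →
      MemLp (fun t => toNewton p μ U (f t)) (ENNReal.ofReal p) (volume.restrict (Icc a b))

/-- Standard mollifiers on the real line. -/
structure IsMollifier (η : ℝ → ℝ) : Prop where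
  smooth : ContDiff ℝ (⊤ : ℕ∞) η
  nonneg : ∀ s, 0 ≤ η s
  support : tsupport η ⊆ Icc (-1) 1
  integral_eq_one : ∫ s, η s = 1

/-- `F` is the time mollification `f_ε`: for all `t` with `[t-ε, t+ε] ⊂ (0,τ)`, the function
`F t ∈ N^{1,p}_loc(Ω)` is `∫_{-ε}^{ε} η_ε(s) f(t-s) ds` with `η_ε(s) = ε⁻¹ η(s/ε)`, a Bochner
integral in `N^{1,p}(U)` for each open `U ⋐ Ω`. -/
def IsTimeMollification (p : ℝ) [Fact (1 ≤ p)] (μ : Measure X) (Ω : Set X) (τ : ℝ)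
    (η : ℝ → ℝ) (ε : ℝ) (f F : ℝ → X → ℝ) : Prop :=
  ∀ t ∈ Ioo ε (τ - ε), MemNewtonLoc p μ Ω (F t) ∧
    ∀ U : Set X, IsOpen U → WellInside U Ω →
      toNewton p μ U (F t) = ∫ s in (-ε)..ε, (ε⁻¹ * η (s / ε)) • toNewton p μ U (f (t - s))

/-- `G` is the parabolic minimal `p`-weak upper gradient of `h` in `Ω × J`: a measurable function
of `(x,t)` with `G(·,t)` the minimal `p`-weak upper gradient of `h(t)` for almost every `t`. -/
def IsParabolicMinUpperGradient (p : ℝ) (μ : Measure X) (Ω : Set X) (J : Set ℝ)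
    (h : ℝ → X → ℝ) (G : X × ℝ → ℝ≥0∞) : Prop :=
  Measurable G ∧ ∀ᵐ t ∂(volume.restrict J),
    IsMinWeakUpperGradientLoc p μ Ω (h t) (fun x => G (x, t))

end NewtonSobolev

end

/-!
If the functions `v_k` have weak upper gradients with summable norms in `L^p(U)`, then the series
`∑ v_k` converges uniformly along `p`-almost every curve; this makes `N^{1,p}(U)` complete. Minimal
weak upper gradients are local, that is, compatible with restriction to smaller open sets, which
gives `‖g_h‖_{L^p(U × I)} ≤ ‖h‖_{L^p(I; N^{1,p}(U))}` and reduces both claims to the continuity of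
translations and the convergence of mollifications in the Bochner space `L^p(ℝ; N^{1,p}(U))`.

The function `g_h` is jointly measurable in `(x, t)` when `h` takes countably many values. A
strongly measurable `h` is approximated by such maps with summable errors, and their minimal weak
upper gradients converge almost everywhere, as `|g_u - g_v| ≤ g_{u-v}`.
-/

noncomputable section

namespace NewtonSobolev

section AbsolutelyContinuous

variable {Y Z : Type*} [PseudoMetricSpace Y] [PseudoMetricSpace Z] {a b : ℝ}

lemma absolutelyContinuousOnInterval_of_dist_le {φ : ℝ → Y} {ψ : ℝ → Z}
    (hψ : AbsolutelyContinuousOnInterval ψ a b)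
    (h : ∀ x ∈ uIcc a b, ∀ y ∈ uIcc a b, dist (φ x) (φ y) ≤ dist (ψ x) (ψ y)) :
    AbsolutelyContinuousOnInterval φ a b := by
  rw [absolutelyContinuousOnInterval_iff] at hψ ⊢
  intro ε hε
  obtain ⟨δ, hδ, H⟩ := hψ ε hε
  refine ⟨δ, hδ, fun E hE hl => lt_of_le_of_lt ?_ (H E hE hl)⟩
  exact Finset.sum_le_sum fun i hi => h _ (hE.1 i hi).1 _ (hE.1 i hi).2

lemma absolutelyContinuousOnInterval_dist {γ : ℝ → Y}
    (hγ : AbsolutelyContinuousOnInterval γ a b) (x : Y) :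
    AbsolutelyContinuousOnInterval (fun t => dist (γ t) x) a b :=
  absolutelyContinuousOnInterval_of_dist_le hγ fun _ _ _ _ => abs_dist_sub_le _ _ _

lemma continuousOn_of_absolutelyContinuousOnInterval {γ : ℝ → Y}
    (hγ : AbsolutelyContinuousOnInterval γ a b) : ContinuousOn γ (uIcc a b) := fun t ht => by
  refine tendsto_iff_dist_tendsto_zero.2 ?_
  simpa only [ContinuousWithinAt, dist_self] using
    (absolutelyContinuousOnInterval_dist hγ (γ t)).continuousOn t ht

lemma disjoint_uIoc_image_of_monotoneOn {g : ℝ → ℝ} {s : Set ℝ} (hg : MonotoneOn g s)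
    {x y x' y' : ℝ} (hx : x ∈ s) (hy : y ∈ s) (hx' : x' ∈ s) (hy' : y' ∈ s)
    (h : Disjoint (uIoc x y) (uIoc x' y')) :
    Disjoint (uIoc (g x) (g y)) (uIoc (g x') (g y')) := by
  have mem_min {u v : ℝ} (hu : u ∈ s) (hv : v ∈ s) : min u v ∈ s := min_rec' (· ∈ s) hu hv
  have mem_max {u v : ℝ} (hu : u ∈ s) (hv : v ∈ s) : max u v ∈ s := max_rec' (· ∈ s) hu hv
  rw [uIoc, uIoc, ← hg.map_min hx hy, ← hg.map_max hx hy, ← hg.map_min hx' hy',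
    ← hg.map_max hx' hy', Ioc_disjoint_Ioc,
    ← hg.map_min (mem_max hx hy) (mem_max hx' hy'), ← hg.map_max (mem_min hx hy) (mem_min hx' hy')]
  exact hg (mem_min (mem_max hx hy) (mem_max hx' hy')) (mem_max (mem_min hx hy) (mem_min hx' hy'))
    (Ioc_disjoint_Ioc.1 h)

lemma absolutelyContinuousOnInterval_comp_of_monotoneOn {γ : ℝ → Y} {g : ℝ → ℝ} {c d : ℝ}
    {L : NNReal} (hγ : AbsolutelyContinuousOnInterval γ a b) (hg : MonotoneOn g (uIcc c d))
    (hL : LipschitzOnWith L g (uIcc c d)) (hmaps : MapsTo g (uIcc c d) (uIcc a b)) :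
    AbsolutelyContinuousOnInterval (γ ∘ g) c d := by
  rw [absolutelyContinuousOnInterval_iff] at hγ ⊢
  intro ε hε
  obtain ⟨δ, hδ, H⟩ := hγ ε hε
  refine ⟨δ / (L + 1), by positivity, fun E hE hl => ?_⟩
  refine H (E.1, fun i => (g (E.2 i).1, g (E.2 i).2)) ⟨?_, ?_⟩ ?_
  · exact fun i hi => ⟨hmaps (hE.1 i hi).1, hmaps (hE.1 i hi).2⟩
  · exact fun i hi j hj hij => disjoint_uIoc_image_of_monotoneOn hg (hE.1 i hi).1 (hE.1 i hi).2
      (hE.1 j hj).1 (hE.1 j hj).2 (hE.2 hi hj hij)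
  · calc ∑ i ∈ Finset.range E.1, dist (g (E.2 i).1) (g (E.2 i).2)
        ≤ ∑ i ∈ Finset.range E.1, (L + 1) * dist (E.2 i).1 (E.2 i).2 := by
          gcongr with i hi
          exact (hL.dist_le_mul _ (hE.1 i hi).1 _ (hE.1 i hi).2).trans (by gcongr; simp)
      _ < δ := by
          rwa [← Finset.mul_sum, ← lt_div_iff₀' (by positivity)]

lemma ofReal_abs_sub_le_lintegral_enorm_deriv {φ : ℝ → ℝ} (hab : a ≤ b)
    (hφ : AbsolutelyContinuousOnInterval φ a b) :
    ENNReal.ofReal |φ b - φ a| ≤ ∫⁻ t in Icc a b, ‖deriv φ t‖ₑ := by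
  rw [← hφ.integral_deriv_eq_sub, intervalIntegral.integral_of_le hab,
    ← integral_Icc_eq_integral_Ioc, ← Real.norm_eq_abs, ofReal_norm]
  exact enorm_integral_le_lintegral_enorm _

lemma abs_le_of_hasDerivAt_of_eventually_abs_sub_le {φ ψ : ℝ → ℝ} {φ' ψ' t : ℝ}
    (hφ : HasDerivAt φ φ' t) (hψ : HasDerivAt ψ ψ' t)
    (h : ∀ᶠ s in 𝓝[>] t, |φ s - φ t| ≤ ψ s - ψ t) : |φ'| ≤ ψ' := by
  have hright : 𝓝[>] t ≤ 𝓝[≠] t := nhdsWithin_mono t fun _ hs => ne_of_gt hs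
  refine le_of_tendsto_of_tendsto ((hasDerivAt_iff_tendsto_slope.1 hφ).mono_left hright).abs
    ((hasDerivAt_iff_tendsto_slope.1 hψ).mono_left hright) ?_
  filter_upwards [h, self_mem_nhdsWithin] with s hs hts
  have hpos : 0 < s - t := sub_pos.2 hts
  rw [slope_def_field, slope_def_field, abs_div, abs_of_pos hpos]
  gcongr

section lintegral

variable {H : ℝ → ℝ≥0∞} (hH : AEMeasurable H (volume.restrict (Icc a b)))
  (hfin : ∫⁻ t in Icc a b, H t ≠ ∞)

include hH hfin

lemma intervalIntegrable_toReal {c d : ℝ} (hc : c ∈ Icc a b) (hd : d ∈ Icc a b) :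
    IntervalIntegrable (fun t => (H t).toReal) volume c d :=
  (IntegrableOn.mono_set (integrable_toReal_of_lintegral_ne_top hH hfin)
    (ordConnected_Icc.uIcc_subset hc hd)).intervalIntegrable

lemma lintegral_Icc_eq_ofReal_integral_sub {c d : ℝ} (hac : a ≤ c) (hcd : c ≤ d) (hdb : d ≤ b) :
    ∫⁻ t in Icc c d, H t =
      ENNReal.ofReal ((∫ t in a..d, (H t).toReal) - ∫ t in a..c, (H t).toReal) := by
  have ha : a ∈ Icc a b := ⟨le_rfl, hac.trans (hcd.trans hdb)⟩
  have hsub : Icc c d ⊆ Icc a b := Icc_subset_Icc hac hdb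
  have hm : AEMeasurable H (volume.restrict (Icc c d)) := hH.mono_set hsub
  have hf : ∫⁻ t in Icc c d, H t ≠ ∞ := ne_top_of_le_ne_top hfin (lintegral_mono_set hsub)
  rw [intervalIntegral.integral_interval_sub_left
      (intervalIntegrable_toReal hH hfin ha (hsub (right_mem_Icc.2 hcd)))
      (intervalIntegrable_toReal hH hfin ha (hsub (left_mem_Icc.2 hcd))),
    intervalIntegral.integral_of_le hcd, ← integral_Icc_eq_integral_Ioc,
    integral_toReal hm (ae_lt_top' hm hf), ENNReal.ofReal_toReal hf]

lemma integral_toReal_mono {c d : ℝ} (hac : a ≤ c) (hcd : c ≤ d) (hdb : d ≤ b) :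
    ∫ t in a..c, (H t).toReal ≤ ∫ t in a..d, (H t).toReal :=
  intervalIntegral.integral_mono_interval le_rfl hac hcd
    (Eventually.of_forall fun _ => ENNReal.toReal_nonneg)
    (intervalIntegrable_toReal hH hfin ⟨le_rfl, hac.trans (hcd.trans hdb)⟩ ⟨hac.trans hcd, hdb⟩)

lemma ofReal_abs_sub_le_lintegral_Icc_iff {φ : ℝ → ℝ} {c d : ℝ} (hac : a ≤ c) (hcd : c ≤ d)
    (hdb : d ≤ b) : ENNReal.ofReal |φ d - φ c| ≤ ∫⁻ t in Icc c d, H t ↔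
      |φ d - φ c| ≤ (∫ t in a..d, (H t).toReal) - ∫ t in a..c, (H t).toReal := by
  rw [lintegral_Icc_eq_ofReal_integral_sub hH hfin hac hcd hdb, ENNReal.ofReal_le_ofReal_iff
    (sub_nonneg.2 (integral_toReal_mono hH hfin hac hcd hdb))]

lemma absolutelyContinuousOnInterval_of_le_lintegral {φ : ℝ → ℝ} (hab : a ≤ b)
    (h : ∀ c d, a ≤ c → c ≤ d → d ≤ b → ENNReal.ofReal |φ d - φ c| ≤ ∫⁻ t in Icc c d, H t) :
    AbsolutelyContinuousOnInterval φ a b := by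
  have hint : IntervalIntegrable (fun t => (H t).toReal) volume a b :=
    intervalIntegrable_toReal hH hfin (left_mem_Icc.2 hab) (right_mem_Icc.2 hab)
  refine absolutelyContinuousOnInterval_of_dist_le
    (hint.absolutelyContinuousOnInterval_intervalIntegral left_mem_uIcc) fun x hx y hy => ?_
  rw [uIcc_of_le hab] at hx hy
  wlog hyx : y ≤ x generalizing x y
  · rw [dist_comm, dist_comm (∫ t in a..x, (H t).toReal)]
    exact this y hy x hx (le_of_not_ge hyx)
  exact ((ofReal_abs_sub_le_lintegral_Icc_iff hH hfin hy.1 hyx hx.2).1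
    (h y x hy.1 hyx hx.2)).trans (le_abs_self _)

lemma ae_enorm_deriv_le_of_eventually_le_lintegral {φ : ℝ → ℝ}
    (hφ : AbsolutelyContinuousOnInterval φ a b) :
    ∀ᵐ t ∂(volume.restrict (Icc a b)),
      (∀ᶠ s in 𝓝[>] t, ENNReal.ofReal |φ s - φ t| ≤ ∫⁻ r in Icc t s, H r) →
        ‖deriv φ t‖ₑ ≤ H t := by
  rcases lt_or_ge b a with hba | hab
  · simp [Icc_eq_empty_of_lt hba]
  have hint : IntervalIntegrable (fun t => (H t).toReal) volume a b :=
    intervalIntegrable_toReal hH hfin (left_mem_Icc.2 hab) (right_mem_Icc.2 hab)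
  rw [ae_restrict_iff' measurableSet_Icc]
  filter_upwards [hφ.ae_differentiableAt, hint.ae_hasDerivAt_integral,
    (countable_singleton b).ae_notMem volume] with t hdiff hderiv htb ht hle
  rw [uIcc_of_le hab] at hdiff hderiv
  have hlt : t < b := lt_of_le_of_ne ht.2 htb
  have key := abs_le_of_hasDerivAt_of_eventually_abs_sub_le (hdiff ht).hasDerivAt
    (hderiv ht a (left_mem_Icc.2 hab)) <| by
      filter_upwards [hle, Ioc_mem_nhdsGT hlt] with s hs hts
      exact (ofReal_abs_sub_le_lintegral_Icc_iff hH hfin ht.1 hts.1.le hts.2).1 hs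
  rw [← ofReal_norm, Real.norm_eq_abs]
  exact (ENNReal.ofReal_le_ofReal key).trans ENNReal.ofReal_toReal_le

end lintegral

end AbsolutelyContinuous

section Curves

variable {X : Type*} [MetricSpace X] {γ : ℝ → X}

lemma measurable_metricSpeed (hγ : Continuous γ) : Measurable (metricSpeed γ) := by
  have hbasis : (𝓝[≠] (0 : ℝ)).HasBasis (fun _ : ℕ => True)
      (fun n => Metric.ball 0 (1 / ((n : ℝ) + 1)) ∩ {0}ᶜ) :=
    nhdsWithin_hasBasis Metric.nhds_basis_ball_inv_nat_succ _
  have heq : metricSpeed γ = fun t => ⨅ n : ℕ,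
      ⨆ h ∈ Metric.ball (0 : ℝ) (1 / ((n : ℝ) + 1)) ∩ {0}ᶜ,
        edist (γ (t + h)) (γ t) / ENNReal.ofReal |h| := by
    ext t
    simp only [metricSpeed, hbasis.limsup_eq_iInf_iSup, iInf_true]
  rw [heq]
  refine Measurable.iInf fun n => LowerSemicontinuous.measurable ?_
  refine lowerSemicontinuous_iSup fun h => lowerSemicontinuous_iSup fun hh => ?_
  have h0 : ENNReal.ofReal |h| ≠ 0 := by simpa using hh.2
  simp only [div_eq_mul_inv]
  exact ((ENNReal.continuous_mul_const (ENNReal.inv_ne_top.2 h0)).comp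
    ((hγ.comp (continuous_add_const h)).edist hγ)).lowerSemicontinuous

lemma metricSpeed_congr {γ' : ℝ → X} {t : ℝ} (h : γ =ᶠ[𝓝 t] γ') :
    metricSpeed γ t = metricSpeed γ' t := by
  have hshift : Tendsto (fun s : ℝ => t + s) (𝓝[≠] 0) (𝓝 t) :=
    ((continuous_const_add t).tendsto' 0 t (add_zero t)).mono_left nhdsWithin_le_nhds
  refine limsup_congr ?_
  filter_upwards [hshift.eventually h] with s hs
  rw [hs, h.eq_of_nhds]

lemma aemeasurable_metricSpeed {a b : ℝ} (hab : a ≤ b) (hγ : ContinuousOn γ (Icc a b)) :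
    AEMeasurable (metricSpeed γ) (volume.restrict (Icc a b)) := by
  refine ⟨_, measurable_metricSpeed
    ((continuousOn_iff_continuous_domRestrict.1 hγ).Icc_extend' (h := hab)), ?_⟩
  rw [← Measure.restrict_congr_set (Ioo_ae_eq_Icc (μ := volume))]
  refine (ae_restrict_iff' measurableSet_Ioo).2 (Eventually.of_forall fun t ht => ?_)
  refine metricSpeed_congr ?_
  filter_upwards [Ioo_mem_nhds ht.1 ht.2] with s hs
  exact (IccExtend_of_mem hab ((Icc a b).domRestrict γ) ⟨hs.1.le, hs.2.le⟩).symm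

lemma enorm_deriv_dist_le_metricSpeed (γ : ℝ → X) (x : X) (t : ℝ) :
    ‖deriv (fun s => dist (γ s) x) t‖ₑ ≤ metricSpeed γ t := by
  by_cases hdiff : DifferentiableAt ℝ (fun s => dist (γ s) x) t
  swap
  · simp [deriv_zero_of_not_differentiableAt hdiff]
  have hlim := (continuous_enorm.tendsto _).comp
    (hasDerivAt_iff_tendsto_slope_zero.1 hdiff.hasDerivAt)
  rw [← hlim.limsup_eq]
  refine limsup_le_limsup ?_
  filter_upwards [self_mem_nhdsWithin] with h hh
  simp only [Function.comp]
  rw [smul_eq_mul, enorm_mul, enorm_inv hh, mul_comm, ← div_eq_mul_inv, ← ofReal_norm,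
    ← ofReal_norm h, edist_dist, Real.norm_eq_abs, Real.norm_eq_abs]
  gcongr
  exact abs_dist_sub_le _ _ _

lemma edist_le_lintegral_metricSpeed {a b : ℝ} (hab : a ≤ b)
    (hγ : AbsolutelyContinuousOnInterval γ a b) :
    edist (γ b) (γ a) ≤ ∫⁻ t in Icc a b, metricSpeed γ t := by
  have h := ofReal_abs_sub_le_lintegral_enorm_deriv hab
    (absolutelyContinuousOnInterval_dist hγ (γ a))
  simp only [dist_self, sub_zero, abs_of_nonneg dist_nonneg, ← edist_dist] at h
  exact h.trans (lintegral_mono fun t => enorm_deriv_dist_le_metricSpeed γ _ t)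

/-- The restriction of `γ` to `[a, b]`, parametrized by `[0, 1]` with constant factor `b - a`. -/
def subcurve {Y : Type*} (γ : ℝ → Y) (a b : ℝ) (t : ℝ) : Y := γ (a + (b - a) * t)

@[simp]
lemma subcurve_apply_zero {Y : Type*} (γ : ℝ → Y) (a b : ℝ) : subcurve γ a b 0 = γ a := by
  simp [subcurve]

@[simp]
lemma subcurve_apply_one {Y : Type*} (γ : ℝ → Y) (a b : ℝ) : subcurve γ a b 1 = γ b := by
  simp [subcurve]

lemma absolutelyContinuousOnInterval_subcurve {a b : ℝ} (hab : a ≤ b)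
    (hγ : AbsolutelyContinuousOnInterval γ a b) :
    AbsolutelyContinuousOnInterval (subcurve γ a b) 0 1 := by
  refine absolutelyContinuousOnInterval_comp_of_monotoneOn (g := fun t => a + (b - a) * t)
    (L := (b - a).toNNReal) hγ ?_ ?_ ?_
  · intro s _ t _ hst
    have := sub_nonneg.2 hab
    dsimp only
    gcongr
  · refine LipschitzOnWith.of_dist_le_mul fun s _ t _ => le_of_eq ?_
    rw [Real.coe_toNNReal _ (sub_nonneg.2 hab), Real.dist_eq, Real.dist_eq,
      add_sub_add_left_eq_sub, ← mul_sub, abs_mul, abs_of_nonneg (sub_nonneg.2 hab)]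
  · exact fun t ht => by
      rw [uIcc_of_le zero_le_one] at ht
      rw [uIcc_of_le hab]
      constructor <;> nlinarith [ht.1, ht.2]

lemma IsACCurve.subcurve {U V : Set X} (hγ : IsACCurve U γ) {a b : ℝ} (ha : 0 ≤ a)
    (hab : a ≤ b) (hb : b ≤ 1) (hV : ∀ t ∈ Icc a b, γ t ∈ V) : IsACCurve V (subcurve γ a b) := by
  refine ⟨absolutelyContinuousOnInterval_subcurve hab (hγ.1.mono ?_),
    fun t ht => hV _ (by constructor <;> nlinarith [ht.1, ht.2])⟩
  rw [uIcc_of_le hab, uIcc_of_le zero_le_one]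
  exact Icc_subset_Icc ha hb

lemma IsACCurve.mono {U V : Set X} (h : U ⊆ V) (hγ : IsACCurve U γ) : IsACCurve V γ :=
  ⟨hγ.1, fun t ht => h (hγ.2 t ht)⟩

lemma IsACCurve.continuousOn {U : Set X} (hγ : IsACCurve U γ) : ContinuousOn γ (Icc 0 1) := by
  simpa only [uIcc_of_le zero_le_one] using continuousOn_of_absolutelyContinuousOnInterval hγ.1

lemma map_const_mul_nhdsNE_zero {c : ℝ} (hc : c ≠ 0) :
    map (fun h : ℝ => c * h) (𝓝[≠] 0) = 𝓝[≠] 0 := by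
  simpa using (Homeomorph.mulLeft₀ c hc).map_punctured_nhds_eq 0

lemma metricSpeed_subcurve (γ : ℝ → X) {a b : ℝ} (hab : a < b) (t : ℝ) :
    metricSpeed (subcurve γ a b) t =
      ENNReal.ofReal (b - a) * metricSpeed γ (a + (b - a) * t) := by
  have hpos : 0 < b - a := sub_pos.2 hab
  have hne : ENNReal.ofReal (b - a) ≠ 0 := (ENNReal.ofReal_pos.2 hpos).ne'
  conv_rhs => rw [metricSpeed, ← map_const_mul_nhdsNE_zero hpos.ne']
  rw [← ENNReal.limsup_const_mul_of_ne_top ENNReal.ofReal_ne_top, ← Filter.limsup_comp]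
  refine limsup_congr (Eventually.of_forall fun h => ?_)
  simp only [Function.comp, subcurve]
  rw [abs_mul, abs_of_pos hpos, ENNReal.ofReal_mul hpos.le, mul_add, ← add_assoc, ← mul_div_assoc,
    ENNReal.mul_div_mul_left _ _ hne ENNReal.ofReal_ne_top]

lemma curveIntegral_subcurve (ρ : X → ℝ≥0∞) (γ : ℝ → X) {a b : ℝ} (hab : a < b) :
    curveIntegral ρ (subcurve γ a b) = ∫⁻ t in Icc a b, ρ (γ t) * metricSpeed γ t := by
  have hpos : 0 < b - a := sub_pos.2 hab
  have himage : (fun t : ℝ => a + (b - a) * t) '' Icc 0 1 = Icc a b := by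
    rw [show (fun t : ℝ => a + (b - a) * t) = fun t => (b - a) * t + a by ext; ring,
      image_affine_Icc' hpos]
    simp
  rw [← himage, lintegral_image_eq_lintegral_abs_deriv_mul measurableSet_Icc (f' := fun _ => b - a)
    (fun x _ => by simpa using
      (((hasDerivAt_id x).const_mul (b - a)).const_add a).hasDerivWithinAt)
    (fun x _ y _ hxy => by simpa [hpos.ne'] using hxy)]
  refine lintegral_congr fun t => ?_
  rw [metricSpeed_subcurve γ hab, abs_of_pos hpos, subcurve]
  ring

lemma curveIntegral_const_mul {c : ℝ≥0∞} (hc : c ≠ ∞) (ρ : X → ℝ≥0∞) (γ : ℝ → X) :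
    curveIntegral (fun x => c * ρ x) γ = c * curveIntegral ρ γ := by
  simp only [curveIntegral, mul_assoc]
  exact lintegral_const_mul' _ _ hc

lemma curveIntegral_congr {ρ σ : X → ℝ≥0∞} (h : ∀ t ∈ Icc (0 : ℝ) 1, ρ (γ t) = σ (γ t)) :
    curveIntegral ρ γ = curveIntegral σ γ :=
  setLIntegral_congr_fun measurableSet_Icc fun t ht => by simp only [h t ht]

end Curves

lemma lintegral_indicator_rpow {Y : Type*} [MeasurableSpace Y] {ν : Measure Y} {U V : Set Y}
    {p : ℝ} (hp : 0 < p) (hV : MeasurableSet V) (hVU : V ⊆ U) (ρ : Y → ℝ≥0∞) :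
    ∫⁻ x in U, V.indicator ρ x ^ p ∂ν = ∫⁻ x in V, ρ x ^ p ∂ν := by
  have hpow (x : Y) : V.indicator ρ x ^ p = V.indicator (fun x => ρ x ^ p) x := by
    by_cases hx : x ∈ V <;> simp [hx, ENNReal.zero_rpow_of_pos hp]
  simp only [hpow]
  rw [lintegral_indicator hV, Measure.restrict_restrict hV, inter_eq_left.2 hVU]

section AECurve

variable {X : Type*} [MetricSpace X] [MeasurableSpace X] {p : ℝ} {μ : Measure X} {U V : Set X}
  {u : X → ℝ} {g h k : X → ℝ≥0∞}

/-- The property `P` holds for `p`-almost every absolutely continuous curve in `U`: the curves where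
it fails have zero `p`-modulus. -/
def AECurve (p : ℝ) (μ : Measure X) (U : Set X) (P : (ℝ → X) → Prop) : Prop :=
  modulus p μ U {γ | IsACCurve U γ ∧ ¬ P γ} = 0

lemma IsWeakUpperGradient.aeCurve (hg : IsWeakUpperGradient p μ U u g) :
    AECurve p μ U (fun γ => ENNReal.ofReal |u (γ 1) - u (γ 0)| ≤ curveIntegral g γ) :=
  hg.2

lemma exists_admissible_of_modulus_eq_zero {Γ : Set (ℝ → X)} (hΓ : modulus p μ U Γ = 0)
    {ε : ℝ≥0∞} (hε : 0 < ε) : ∃ ρ : X → ℝ≥0∞, Measurable ρ ∧ (∀ γ ∈ Γ, 1 ≤ curveIntegral ρ γ) ∧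
      ∫⁻ x in U, ρ x ^ p ∂μ < ε := by
  rw [← hΓ] at hε
  simpa only [modulus, iInf_lt_iff, exists_prop] using hε

lemma modulus_eq_zero_of_forall_exists_admissible {Γ : Set (ℝ → X)}
    (h : ∀ ε : ℝ≥0∞, 0 < ε → ∃ ρ : X → ℝ≥0∞, Measurable ρ ∧ (∀ γ ∈ Γ, 1 ≤ curveIntegral ρ γ) ∧
      ∫⁻ x in U, ρ x ^ p ∂μ ≤ ε) : modulus p μ U Γ = 0 := by
  refine le_antisymm (le_of_forall_gt_imp_ge_of_dense fun ε hε => ?_) bot_le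
  obtain ⟨ρ, hρ, hadm, hint⟩ := h ε hε
  exact iInf_le_of_le ρ (iInf_le_of_le hρ (iInf_le_of_le hadm hint))

lemma modulus_mono_set (hVU : V ⊆ U) (Γ : Set (ℝ → X)) : modulus p μ V Γ ≤ modulus p μ U Γ :=
  iInf_mono fun _ => iInf_mono fun _ => iInf_mono fun _ => lintegral_mono_set hVU

lemma AECurve.mono {P Q : (ℝ → X) → Prop} (hP : AECurve p μ U P)
    (h : ∀ γ, IsACCurve U γ → P γ → Q γ) : AECurve p μ U Q := by
  have hsub : {γ | IsACCurve U γ ∧ ¬ Q γ} ⊆ {γ | IsACCurve U γ ∧ ¬ P γ} :=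
    fun γ hγ => ⟨hγ.1, fun hPγ => hγ.2 (h γ hγ.1 hPγ)⟩
  exact le_antisymm ((modulus_mono hsub).trans hP.le) bot_le

lemma AECurve.mono_set {P : (ℝ → X) → Prop} (hVU : V ⊆ U) (hP : AECurve p μ U P) :
    AECurve p μ V P := by
  have hsub : {γ | IsACCurve V γ ∧ ¬ P γ} ⊆ {γ | IsACCurve U γ ∧ ¬ P γ} :=
    fun γ hγ => ⟨hγ.1.mono hVU, hγ.2⟩
  exact le_antisymm (((modulus_mono_set hVU _).trans (modulus_mono hsub)).trans hP.le) bot_le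

lemma aeCurve_forall {ι : Type*} [Countable ι] (hp : 0 < p) {P : ι → (ℝ → X) → Prop}
    (h : ∀ i, AECurve p μ U (P i)) : AECurve p μ U (fun γ => ∀ i, P i γ) := by
  refine modulus_eq_zero_of_forall_exists_admissible fun ε hε => ?_
  obtain ⟨ε', hpos, hsum⟩ := ENNReal.exists_pos_sum_of_countable' hε.ne' ι
  choose ρ hρ hadm hint using fun i => exists_admissible_of_modulus_eq_zero (h i) (hpos i)
  refine ⟨fun x => ⨆ i, ρ i x, .iSup hρ, ?_, ?_⟩
  · rintro γ ⟨hγ, hPγ⟩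
    obtain ⟨i, hi⟩ := not_forall.1 hPγ
    exact (hadm i γ ⟨hγ, hi⟩).trans (curveIntegral_mono (fun x => le_iSup (fun i => ρ i x) i) γ)
  · calc ∫⁻ x in U, (⨆ i, ρ i x) ^ p ∂μ ≤ ∫⁻ x in U, ∑' i, ρ i x ^ p ∂μ := by
          refine lintegral_mono fun x => ?_
          rw [show (⨆ i, ρ i x) ^ p = ⨆ i, ρ i x ^ p from (ENNReal.orderIsoRpow p hp).map_iSup _]
          exact iSup_le fun i => ENNReal.le_tsum i
      _ = ∑' i, ∫⁻ x in U, ρ i x ^ p ∂μ := lintegral_tsum fun i => ((hρ i).pow_const p).aemeasurable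
      _ ≤ ∑' i, ε' i := ENNReal.tsum_le_tsum fun i => (hint i).le
      _ ≤ ε := hsum.le

lemma AECurve.and (hp : 0 < p) {P Q : (ℝ → X) → Prop} (hP : AECurve p μ U P)
    (hQ : AECurve p μ U Q) : AECurve p μ U (fun γ => P γ ∧ Q γ) := by
  refine (aeCurve_forall hp (P := fun b : Bool => cond b P Q) ?_).mono
    fun γ _ hγ => ⟨hγ true, hγ false⟩
  rintro (_ | _)
  exacts [hQ, hP]

lemma aeCurve_curveIntegral_ne_top (hp : 0 < p) {ρ : X → ℝ≥0∞} (hρ : Measurable ρ)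
    (hfin : ∫⁻ x in U, ρ x ^ p ∂μ < ∞) : AECurve p μ U (fun γ => curveIntegral ρ γ ≠ ∞) := by
  refine modulus_eq_zero_of_forall_exists_admissible fun ε hε => ?_
  have hlim : Tendsto (fun n : ℕ => ((n : ℝ≥0∞)⁻¹) ^ p * ∫⁻ x in U, ρ x ^ p ∂μ) atTop (𝓝 0) := by
    have h := ((ENNReal.continuous_rpow_const (y := p)).tendsto 0).comp
      ENNReal.tendsto_inv_nat_nhds_zero
    rw [ENNReal.zero_rpow_of_pos hp] at h
    simpa using ENNReal.Tendsto.mul_const h (Or.inr hfin.ne)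
  obtain ⟨n, hnε, hn1⟩ := ((hlim.eventually_lt_const hε).and (eventually_ge_atTop 1)).exists
  have hn_top : (n : ℝ≥0∞)⁻¹ ≠ ∞ := ENNReal.inv_ne_top.2 (by exact_mod_cast Nat.ne_of_gt hn1)
  refine ⟨fun x => (n : ℝ≥0∞)⁻¹ * ρ x, hρ.const_mul _, ?_, ?_⟩
  · rintro γ ⟨-, hγ⟩
    rw [curveIntegral_const_mul hn_top, not_not.1 hγ, ENNReal.mul_top (by simp)]
    exact le_top
  · simp only [ENNReal.mul_rpow_of_nonneg _ _ hp.le]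
    rw [lintegral_const_mul' _ _ (ENNReal.rpow_ne_top_of_nonneg hp.le hn_top)]
    exact hnε.le

/- A density admissible for the curves in `V`, extended by zero, is admissible for the curves in `U`
that contain one of them. -/
lemma AECurve.subcurve (hp : 0 < p) (hV : MeasurableSet V) (hVU : V ⊆ U) {P : (ℝ → X) → Prop}
    (hP : AECurve p μ V P) :
    AECurve p μ U (fun γ => ∀ a b, 0 ≤ a → a < b → b ≤ 1 → (∀ t ∈ Icc a b, γ t ∈ V) →
      P (subcurve γ a b)) := by
  refine modulus_eq_zero_of_forall_exists_admissible fun ε hε => ?_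
  obtain ⟨ρ, hρ, hadm, hint⟩ := exists_admissible_of_modulus_eq_zero hP hε
  refine ⟨V.indicator ρ, hρ.indicator hV, ?_,
    (lintegral_indicator_rpow hp hV hVU ρ).trans_le hint.le⟩
  rintro γ ⟨hγ, hPγ⟩
  push Not at hPγ
  obtain ⟨a, b, ha, hab, hb, hmem, hnot⟩ := hPγ
  have hsub := hγ.subcurve ha hab.le hb hmem
  calc 1 ≤ curveIntegral ρ (NewtonSobolev.subcurve γ a b) := hadm _ ⟨hsub, hnot⟩
    _ = curveIntegral (V.indicator ρ) (NewtonSobolev.subcurve γ a b) :=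
      curveIntegral_congr fun t ht => by rw [indicator_of_mem (hsub.2 t ht)]
    _ = ∫⁻ t in Icc a b, V.indicator ρ (γ t) * metricSpeed γ t := curveIntegral_subcurve _ _ hab
    _ ≤ curveIntegral (V.indicator ρ) γ := lintegral_mono_set (Icc_subset_Icc ha hb)

lemma IsWeakUpperGradient.mono_set (hVU : V ⊆ U) (hg : IsWeakUpperGradient p μ U u g) :
    IsWeakUpperGradient p μ V u g :=
  ⟨hg.1, hg.aeCurve.mono_set hVU⟩

lemma IsWeakUpperGradient.aeCurve_le_lintegral_Icc (hp : 0 < p) (hV : MeasurableSet V) (hVU : V ⊆ U)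
    (hg : IsWeakUpperGradient p μ V u g) :
    AECurve p μ U (fun γ => ∀ a b, 0 ≤ a → a ≤ b → b ≤ 1 → (∀ t ∈ Icc a b, γ t ∈ V) →
      ENNReal.ofReal |u (γ b) - u (γ a)| ≤ ∫⁻ t in Icc a b, g (γ t) * metricSpeed γ t) := by
  refine (hg.aeCurve.subcurve hp hV hVU).mono fun γ _ hγ a b ha hab hb hmem => ?_
  rcases hab.eq_or_lt with rfl | hab
  · simp
  · simpa only [subcurve_apply_one, subcurve_apply_zero, curveIntegral_subcurve _ _ hab] using
      hγ a b ha hab hb hmem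

lemma isWeakUpperGradient_of_aeCurve_enorm_deriv_le (hk : Measurable k)
    (h : AECurve p μ U (fun γ => AbsolutelyContinuousOnInterval (u ∘ γ) 0 1 ∧
      ∀ᵐ t ∂(volume.restrict (Icc (0 : ℝ) 1)),
        ‖deriv (u ∘ γ) t‖ₑ ≤ k (γ t) * metricSpeed γ t)) :
    IsWeakUpperGradient p μ U u k :=
  ⟨hk, h.mono fun _ _ hγ => (ofReal_abs_sub_le_lintegral_enorm_deriv zero_le_one hγ.1).trans
    (lintegral_mono_ae hγ.2)⟩

variable [BorelSpace X]

lemma IsACCurve.aemeasurable_mul_metricSpeed {γ : ℝ → X} (hγ : IsACCurve U γ)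
    (hg : Measurable g) :
    AEMeasurable (fun t => g (γ t) * metricSpeed γ t) (volume.restrict (Icc 0 1)) :=
  (hg.comp_aemeasurable (hγ.continuousOn.aemeasurable measurableSet_Icc)).mul
    (aemeasurable_metricSpeed zero_le_one hγ.continuousOn)

lemma aeCurve_ae_metricSpeed_eq_zero (hp : 0 < p) {E : Set X} (hE : MeasurableSet E)
    (hE0 : μ.restrict U E = 0) : AECurve p μ U (fun γ =>
      ∀ᵐ t ∂(volume.restrict (Icc (0 : ℝ) 1)), γ t ∈ E → metricSpeed γ t = 0) := by
  have hm : Measurable (E.indicator (fun _ => (∞ : ℝ≥0∞))) := measurable_const.indicator hE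
  have hint : ∫⁻ x in U, E.indicator (fun _ => (∞ : ℝ≥0∞)) x ^ p ∂μ = 0 := by
    rw [lintegral_eq_zero_iff (hm.pow_const p)]
    filter_upwards [measure_eq_zero_iff_ae_notMem.1 hE0] with x hx
    simp [hx, ENNReal.zero_rpow_of_pos hp]
  refine (aeCurve_curveIntegral_ne_top hp hm (hint.trans_lt ENNReal.zero_lt_top)).mono
    fun γ hγ hfin => ?_
  filter_upwards [ae_lt_top' (hγ.aemeasurable_mul_metricSpeed hm) hfin] with t ht htE
  by_contra hne
  simp [htE, ENNReal.top_mul hne] at ht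

lemma aeCurve_exists_notMem (hp : 0 < p) {E : Set X} (hE : MeasurableSet E)
    (hE0 : μ.restrict U E = 0) : AECurve p μ U (fun γ =>
      γ 1 ≠ γ 0 → ∃ t ∈ Icc (0 : ℝ) 1, γ t ∉ E) := by
  refine (aeCurve_ae_metricSpeed_eq_zero hp hE hE0).mono fun γ hγ hspeed hne => ?_
  by_contra! hmem
  have hlen : ∫⁻ t in Icc (0 : ℝ) 1, metricSpeed γ t = 0 := by
    rw [lintegral_eq_zero_iff' (aemeasurable_metricSpeed zero_le_one hγ.continuousOn)]
    filter_upwards [hspeed, ae_restrict_mem measurableSet_Icc] with t ht htI using ht (hmem t htI)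
  exact hne (edist_le_zero.1 ((edist_le_lintegral_metricSpeed zero_le_one hγ.1).trans_eq hlen))

lemma IsWeakUpperGradient.mono_ae (hp : 0 < p) (hg : IsWeakUpperGradient p μ U u g)
    (hk : Measurable k) (hle : ∀ᵐ x ∂(μ.restrict U), g x ≤ k x) :
    IsWeakUpperGradient p μ U u k := by
  have hnull : μ.restrict U {x | k x < g x} = 0 := by
    simpa only [ae_iff, not_le] using hle
  have hmove := aeCurve_ae_metricSpeed_eq_zero hp (measurableSet_lt hk hg.1) hnull
  refine ⟨hk, (hg.aeCurve.and hp hmove).mono ?_⟩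
  rintro γ - ⟨hu, hspeed⟩
  refine hu.trans (lintegral_mono_ae ?_)
  filter_upwards [hspeed] with t ht
  rcases le_or_gt (g (γ t)) (k (γ t)) with hle | hlt
  · gcongr
  · simp [ht hlt]

lemma IsWeakUpperGradient.aeCurve_absolutelyContinuousOnInterval (hp : 0 < p)
    (hU : MeasurableSet U) (hg : IsWeakUpperGradient p μ U u g)
    (hfin : ∫⁻ x in U, g x ^ p ∂μ < ∞) :
    AECurve p μ U (fun γ => AbsolutelyContinuousOnInterval (u ∘ γ) 0 1) := by
  refine ((hg.aeCurve_le_lintegral_Icc hp hU subset_rfl).and hp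
    (aeCurve_curveIntegral_ne_top hp hg.1 hfin)).mono ?_
  rintro γ hγ ⟨hle, hfinγ⟩
  exact absolutelyContinuousOnInterval_of_le_lintegral (hγ.aemeasurable_mul_metricSpeed hg.1) hfinγ
    zero_le_one fun a b ha hab hb =>
      hle a b ha hab hb fun t ht => hγ.2 t ⟨ha.trans ht.1, ht.2.trans hb⟩

lemma IsWeakUpperGradient.aeCurve_enorm_deriv_le (hp : 0 < p) (hV : MeasurableSet V) (hVU : V ⊆ U)
    (hg : IsWeakUpperGradient p μ V u g) (hfin : ∫⁻ x in V, g x ^ p ∂μ < ∞) :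
    AECurve p μ U (fun γ => AbsolutelyContinuousOnInterval (u ∘ γ) 0 1 →
      ∀ᵐ t ∂(volume.restrict (Icc (0 : ℝ) 1)), (∀ᶠ s in 𝓝[Icc 0 1] t, γ s ∈ V) →
        ‖deriv (u ∘ γ) t‖ₑ ≤ g (γ t) * metricSpeed γ t) := by
  have hind : Measurable (V.indicator g) := hg.1.indicator hV
  refine ((hg.aeCurve_le_lintegral_Icc hp hV hVU).and hp (aeCurve_curveIntegral_ne_top hp hind
    ((lintegral_indicator_rpow hp hV hVU g).trans_lt hfin))).mono ?_
  rintro γ hγ ⟨hle, hfinγ⟩ hac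
  filter_upwards [ae_enorm_deriv_le_of_eventually_le_lintegral
    (hγ.aemeasurable_mul_metricSpeed hind) hfinγ hac,
    ae_restrict_of_ae ((countable_singleton (1 : ℝ)).ae_notMem volume),
    ae_restrict_mem measurableSet_Icc] with t hderiv ht1 ht hnear
  have hlt : t < 1 := lt_of_le_of_ne ht.2 ht1
  have hmem : ∀ᶠ s in 𝓝[>] t, ∀ r ∈ Icc t s, γ r ∈ V := by
    have hnear' : ∀ᶠ s in 𝓝[≥] t, γ s ∈ V :=
      (nhdsWithin_Icc_eq_nhdsGE hlt).symm.le.trans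
        (nhdsWithin_mono t (Icc_subset_Icc_left ht.1)) hnear
    obtain ⟨c, htc, hc⟩ := (mem_nhdsGE_iff_exists_Icc_subset (a := t)).1 hnear'
    filter_upwards [Ioc_mem_nhdsGT htc] with s hs r hr using hc ⟨hr.1, hr.2.trans hs.2⟩
  have hind_eq {r : ℝ} (hr : γ r ∈ V) : V.indicator g (γ r) = g (γ r) := indicator_of_mem hr g
  rw [← hind_eq (hnear.self_of_nhdsWithin ht)]
  refine hderiv ?_
  filter_upwards [hmem, Ioc_mem_nhdsGT hlt] with s hs hts
  refine (hle t s ht.1 hts.1.le hts.2 hs).trans_eq ?_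
  exact setLIntegral_congr_fun measurableSet_Icc fun r hr => by simp only [hind_eq (hs r hr)]

/- An integrable weak upper gradient bounds the derivative of `u` along almost every curve, and such
pointwise bounds can be glued. -/
lemma IsWeakUpperGradient.of_min_le (hp : 0 < p) (hU : MeasurableSet U) (hV : IsOpen V)
    (hVU : V ⊆ U) (hg : IsWeakUpperGradient p μ U u g) (hgfin : ∫⁻ x in U, g x ^ p ∂μ < ∞)
    (hh : IsWeakUpperGradient p μ V u h) (hhfin : ∫⁻ x in V, h x ^ p ∂μ < ∞) (hk : Measurable k)
    (hkV : ∀ x ∈ V, min (g x) (h x) ≤ k x) (hkU : ∀ x ∈ U \ V, g x ≤ k x) :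
    IsWeakUpperGradient p μ U u k := by
  refine isWeakUpperGradient_of_aeCurve_enorm_deriv_le hk
    (((hg.aeCurve_absolutelyContinuousOnInterval hp hU hgfin).and hp
      ((hg.aeCurve_enorm_deriv_le hp hU subset_rfl hgfin).and hp
        (hh.aeCurve_enorm_deriv_le hp hV.measurableSet hVU hhfin))).mono ?_)
  rintro γ hγ ⟨hac, hderivU, hderivV⟩
  refine ⟨hac, ?_⟩
  filter_upwards [hderivU hac, hderivV hac, ae_restrict_mem measurableSet_Icc] with t hgt hht ht
  have hle_g := hgt (eventually_mem_nhdsWithin.mono hγ.2)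
  by_cases htV : γ t ∈ V
  · have hle_h := hht ((hγ.continuousOn t ht).eventually (hV.mem_nhds htV))
    refine (le_min hle_g hle_h).trans ?_
    rw [← min_mul_of_nonneg _ _ zero_le]
    exact mul_le_mul_left (hkV _ htV) _
  · exact hle_g.trans (mul_le_mul_left (hkU _ ⟨hγ.2 t ht, htV⟩) _)

lemma IsWeakUpperGradient.min (hp : 0 < p) (hU : IsOpen U) (hg : IsWeakUpperGradient p μ U u g)
    (hgfin : ∫⁻ x in U, g x ^ p ∂μ < ∞) (hh : IsWeakUpperGradient p μ U u h)
    (hhfin : ∫⁻ x in U, h x ^ p ∂μ < ∞) : IsWeakUpperGradient p μ U u (g ⊓ h) :=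
  hg.of_min_le hp hU.measurableSet hU subset_rfl hgfin hh hhfin (hg.1.inf hh.1)
    (fun _ _ => le_rfl) (by simp)

end AECurve

section minimal

lemma exists_lintegral_rpow_le_of_inf_mem {Y : Type*} [MeasurableSpace Y] {ν : Measure Y} {p : ℝ}
    (hp : 0 ≤ p) {S : Set (Y → ℝ≥0∞)} (hS : S.Nonempty)
    (hinf : ∀ g ∈ S, ∀ h ∈ S, g ⊓ h ∈ S)
    (hiInf : ∀ k : ℕ → Y → ℝ≥0∞, (∀ n, k n ∈ S) → Antitone k → ⨅ n, k n ∈ S) :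
    ∃ g ∈ S, ∀ h ∈ S, ∫⁻ x, g x ^ p ∂ν ≤ ∫⁻ x, h x ^ p ∂ν := by
  obtain ⟨r, -, hr, hrS⟩ := exists_seq_tendsto_sInf
    (hS.image fun g : Y → ℝ≥0∞ => ∫⁻ x, g x ^ p ∂ν) (OrderBot.bddBelow _)
  choose g hgS hgr using hrS
  let k (n : ℕ) : Y → ℝ≥0∞ := (Finset.range (n + 1)).inf' Finset.nonempty_range_add_one g
  have hk (n : ℕ) : k n ∈ S :=
    Finset.inf'_induction _ _ (fun g hg h hh => hinf g hg h hh) fun n _ => hgS n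
  have hanti : Antitone k := fun m n hmn =>
    Finset.inf'_mono _ (Finset.range_mono (Nat.succ_le_succ hmn)) _
  refine ⟨⨅ n, k n, hiInf k hk hanti, fun h hh =>
    (ge_of_tendsto' hr fun n => ?_).trans (sInf_le (mem_image_of_mem _ hh))⟩
  rw [← hgr n]
  have hle : ⨅ n, k n ≤ g n := (iInf_le k n).trans (Finset.inf'_le g (Finset.self_mem_range_succ n))
  exact lintegral_mono fun x => ENNReal.rpow_le_rpow (hle x) hp

lemma exists_forall_ae_le_of_inf_mem {Y : Type*} [MeasurableSpace Y] {ν : Measure Y} {p : ℝ}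
    (hp : 0 < p) {S : Set (Y → ℝ≥0∞)} (hS : S.Nonempty)
    (hmeas : ∀ g ∈ S, Measurable g) (hfin : ∀ g ∈ S, ∫⁻ x, g x ^ p ∂ν < ∞)
    (hinf : ∀ g ∈ S, ∀ h ∈ S, g ⊓ h ∈ S)
    (hiInf : ∀ k : ℕ → Y → ℝ≥0∞, (∀ n, k n ∈ S) → Antitone k → ⨅ n, k n ∈ S) :
    ∃ g ∈ S, ∀ h ∈ S, g ≤ᵐ[ν] h := by
  obtain ⟨g, hg, hmin⟩ := exists_lintegral_rpow_le_of_inf_mem (ν := ν) hp.le hS hinf hiInf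
  refine ⟨g, hg, fun h hh => ?_⟩
  have hgh := hinf g hg h hh
  have hle : (fun x => (g ⊓ h) x ^ p) ≤ᵐ[ν] fun x => g x ^ p :=
    ae_of_all _ fun x => ENNReal.rpow_le_rpow inf_le_left hp.le
  filter_upwards [ae_eq_of_ae_le_of_lintegral_le hle (hfin _ hgh).ne
    ((hmeas g hg).pow_const p).aemeasurable (hmin _ hgh)] with x hx
  exact inf_eq_left.1 (ENNReal.rpow_left_injective hp.ne' hx)

variable {X : Type*} [MetricSpace X] [MeasurableSpace X] {p : ℝ} {μ : Measure X} {U V : Set X}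
  {u v : X → ℝ} {g h k : X → ℝ≥0∞}

lemma IsMinWeakUpperGradient.ae_eq (hg : IsMinWeakUpperGradient p μ U u g)
    (hh : IsMinWeakUpperGradient p μ U u h) : g =ᵐ[μ.restrict U] h :=
  EventuallyLE.antisymm (hg.2.2 h hh.1 hh.2.1) (hh.2.2 g hg.1 hg.2.1)

lemma IsMinWeakUpperGradient.eLpNorm_eq (hp : 1 ≤ p) (hg : IsMinWeakUpperGradient p μ U u g) :
    eLpNorm g (ENNReal.ofReal p) (μ.restrict U) = gradNorm p μ U u := by
  refine le_antisymm (le_iInf₂ fun h hh => ?_) (iInf₂_le g hg.1)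
  by_cases hfin : ∫⁻ x in U, h x ^ p ∂μ < ∞
  · exact eLpNorm_mono_enorm_ae (hg.2.2 h hh hfin)
  · rw [← eLpNorm_lt_top_iff_lintegral hp, not_lt_top_iff] at hfin
    exact hfin ▸ le_top

lemma IsWeakUpperGradient.neg (hu : IsWeakUpperGradient p μ U u g) :
    IsWeakUpperGradient p μ U (-u) g := by
  simpa using hu.smul (-1)

lemma IsMinWeakUpperGradient.neg (hg : IsMinWeakUpperGradient p μ U u g) :
    IsMinWeakUpperGradient p μ U (-u) g :=
  ⟨hg.1.neg, hg.2.1, fun h hh hhfin => hg.2.2 h (by simpa using hh.neg) hhfin⟩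

lemma IsMinWeakUpperGradient.ae_le_add (hp : 1 ≤ p) (hg : IsMinWeakUpperGradient p μ U u g)
    (hh : IsMinWeakUpperGradient p μ U v h) (hk : IsMinWeakUpperGradient p μ U (u - v) k) :
    g ≤ᵐ[μ.restrict U] h + k := by
  have hadd : IsWeakUpperGradient p μ U u (h + k) := by simpa using hh.1.add hp hk.1
  refine hg.2.2 _ hadd ((eLpNorm_lt_top_iff_lintegral hp _).1 ?_)
  exact (eLpNorm_add_le hh.1.1.aestronglyMeasurable hk.1.1.aestronglyMeasurable
    (by simpa using hp)).trans_lt (ENNReal.add_lt_top.2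
      ⟨(eLpNorm_lt_top_iff_lintegral hp _).2 hh.2.1, (eLpNorm_lt_top_iff_lintegral hp _).2 hk.2.1⟩)

variable [BorelSpace X]

lemma tendsto_curveIntegral_iInf {k : ℕ → X → ℝ≥0∞} (hk : ∀ n, Measurable (k n))
    (hanti : Antitone k) {γ : ℝ → X} (hγ : IsACCurve U γ) (hfin : curveIntegral (k 0) γ ≠ ∞) :
    Tendsto (fun n => curveIntegral (k n) γ) atTop (𝓝 (curveIntegral (⨅ n, k n) γ)) := by
  have hmeas (n : ℕ) := hγ.aemeasurable_mul_metricSpeed (hk n)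
  have hanti' (t : ℝ) : Antitone fun n => k n (γ t) * metricSpeed γ t :=
    fun m n hmn => mul_le_mul_left (hanti hmn (γ t)) _
  refine tendsto_lintegral_of_dominated_convergence' _ hmeas
    (fun n => ae_of_all _ fun t => hanti' t n.zero_le) hfin ?_
  filter_upwards [ae_lt_top' (hmeas 0) hfin] with t ht
  rw [iInf_apply, ENNReal.iInf_mul' ?_ fun _ => ⟨0⟩]
  · exact tendsto_atTop_iInf (hanti' t)
  · intro htop _
    refine ⟨0, ?_⟩
    by_contra hne
    simp [htop, ENNReal.mul_top hne] at ht

lemma IsWeakUpperGradient.iInf (hp : 0 < p) {k : ℕ → X → ℝ≥0∞}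
    (hk : ∀ n, IsWeakUpperGradient p μ U u (k n)) (hanti : Antitone k)
    (hfin : ∫⁻ x in U, k 0 x ^ p ∂μ < ∞) : IsWeakUpperGradient p μ U u (⨅ n, k n) := by
  have hmeas : Measurable (⨅ n, k n) := by
    rw [show ⨅ n, k n = fun x => ⨅ n, k n x from funext fun x => iInf_apply]
    exact .iInf fun n => (hk n).1
  refine ⟨hmeas, ?_⟩
  refine ((aeCurve_forall hp fun n => (hk n).aeCurve).and hp
    (aeCurve_curveIntegral_ne_top hp (hk 0).1 hfin)).mono ?_
  rintro γ hγ ⟨hle, hfinγ⟩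
  exact ge_of_tendsto' (tendsto_curveIntegral_iInf (fun n => (hk n).1) hanti hγ hfinγ) hle

lemma exists_isMinWeakUpperGradient (hp : 0 < p) (hU : IsOpen U)
    (h : ∃ g, IsWeakUpperGradient p μ U u g ∧ ∫⁻ x in U, g x ^ p ∂μ < ∞) :
    ∃ g, IsMinWeakUpperGradient p μ U u g := by
  have hfin {g k : X → ℝ≥0∞} (hk : ∫⁻ x in U, k x ^ p ∂μ < ∞) (hgk : g ≤ k) :
      ∫⁻ x in U, g x ^ p ∂μ < ∞ :=
    (lintegral_mono fun x => ENNReal.rpow_le_rpow (hgk x) hp.le).trans_lt hk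
  obtain ⟨g, hg, hmin⟩ := exists_forall_ae_le_of_inf_mem (ν := μ.restrict U)
    (S := {g | IsWeakUpperGradient p μ U u g ∧ ∫⁻ x in U, g x ^ p ∂μ < ∞}) hp h
    (fun g hg => hg.1.1) (fun g hg => hg.2)
    (fun g hg k hk => ⟨hg.1.min hp hU hg.2 hk.1 hk.2, hfin hg.2 inf_le_left⟩)
    (fun k hk hanti => ⟨.iInf hp (fun n => (hk n).1) hanti (hk 0).2, hfin (hk 0).2 (iInf_le k 0)⟩)
  exact ⟨g, hg.1, hg.2, fun k hk hkfin => hmin k ⟨hk, hkfin⟩⟩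

lemma IsMinWeakUpperGradient.congr_ae (hp : 0 < p) (hg : IsMinWeakUpperGradient p μ U u g)
    (hk : Measurable k) (h : k =ᵐ[μ.restrict U] g) : IsMinWeakUpperGradient p μ U u k :=
  ⟨hg.1.mono_ae hp hk h.symm.le, (lintegral_congr_ae (h.fun_comp (· ^ p))).trans_lt hg.2.1,
    fun f hf hffin => h.le.trans (hg.2.2 f hf hffin)⟩

/- A better weak upper gradient in `V` could be glued into the minimal one in `U`. -/
lemma IsMinWeakUpperGradient.mono_set (hp : 0 < p) (hU : MeasurableSet U) (hV : IsOpen V)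
    (hVU : V ⊆ U) (hg : IsMinWeakUpperGradient p μ U u g) : IsMinWeakUpperGradient p μ V u g := by
  classical
  refine ⟨hg.1.mono_set hVU, (lintegral_mono_set hVU).trans_lt hg.2.1, fun h hh hhfin => ?_⟩
  let k : X → ℝ≥0∞ := V.piecewise (g ⊓ h) g
  have hkg : k ≤ g := piecewise_le (fun x _ => inf_le_left) fun x _ => le_rfl
  have hk : IsWeakUpperGradient p μ U u k :=
    hg.1.of_min_le hp hU hV hVU hg.2.1 hh hhfin
      (.piecewise hV.measurableSet (hg.1.1.inf hh.1) hg.1.1)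
      (fun x hx => by simp [k, hx]) (fun x hx => by simp [k, hx.2])
  have hgk := hg.2.2 k hk
    ((lintegral_mono fun x => ENNReal.rpow_le_rpow (hkg x) hp.le).trans_lt hg.2.1)
  filter_upwards [ae_restrict_of_ae_restrict_of_subset hVU hgk,
    ae_restrict_mem hV.measurableSet] with x hx hxV
  exact hx.trans (by simp [k, hxV])

end minimal

section exhaustion

variable {X : Type*} [MetricSpace X] {Ω : Set X}

lemma wellInside_of_le_infEDist_compl {Y : Type*} [PseudoMetricSpace Y] {A B : Set Y}
    (hA : Bornology.IsBounded A) {r : ℝ} (hr : 0 < r)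
    (h : ∀ x ∈ A, ENNReal.ofReal r ≤ Metric.infEDist x Bᶜ) : WellInside A B := by
  have hdist : ∀ x ∈ A, ∀ y ∉ B, r ≤ dist x y := fun x hx y hy => by
    rw [← ENNReal.ofReal_le_ofReal_iff dist_nonneg, ← edist_dist]
    exact (h x hx).trans (Metric.infEDist_le_edist_of_mem hy)
  refine ⟨fun x hx => ?_, hA, r, hr, hdist⟩
  by_contra hxB
  exact absurd (hdist x hx x hxB) (by simpa using hr)

lemma WellInside.exists_le_infEDist_compl {Y : Type*} [PseudoMetricSpace Y] {A B : Set Y}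
    (h : WellInside A B) :
    ∃ r : ℝ, 0 < r ∧ ∀ x ∈ A, ENNReal.ofReal r ≤ Metric.infEDist x Bᶜ := by
  obtain ⟨-, -, r, hr, hdist⟩ := h
  refine ⟨r, hr, fun x hx => Metric.le_infEDist.2 fun y hy => ?_⟩
  rw [edist_dist]
  exact ENNReal.ofReal_le_ofReal (hdist x hx y hy)

/-- An increasing sequence of open sets `U n ⋐ Ω` that absorbs every `V ⋐ Ω`; it reduces statements
about all open `V ⋐ Ω` to countably many. -/
structure IsExhaustion (Ω : Set X) (U : ℕ → Set X) : Prop where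
  isOpen : ∀ n, IsOpen (U n)
  mono : Monotone U
  wellInside : ∀ n, WellInside (U n) Ω
  cofinal : ∀ V, WellInside V Ω → ∃ n, V ⊆ U n

lemma exists_isExhaustion (Ω : Set X) : ∃ U : ℕ → Set X, IsExhaustion Ω U := by
  rcases isEmpty_or_nonempty X with hX | ⟨⟨x₀⟩⟩
  · exact ⟨fun _ => ∅, fun _ => isOpen_empty, monotone_const, fun _ =>
      wellInside_of_le_infEDist_compl Bornology.isBounded_empty one_pos (by simp),
      fun V _ => ⟨0, fun x => isEmptyElim x⟩⟩
  refine ⟨fun n => Metric.ball x₀ n ∩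
    {x | ENNReal.ofReal (1 / ((n : ℝ) + 1)) < Metric.infEDist x Ωᶜ}, ?_, ?_, ?_, ?_⟩
  · exact fun n => Metric.isOpen_ball.inter
      (isOpen_lt continuous_const Metric.continuous_infEDist)
  · exact fun m n hmn x hx => ⟨Metric.ball_subset_ball (by exact_mod_cast hmn) hx.1,
      (ENNReal.ofReal_le_ofReal (Nat.one_div_le_one_div hmn)).trans_lt hx.2⟩
  · exact fun n => wellInside_of_le_infEDist_compl (Metric.isBounded_ball.subset inter_subset_left)
      Nat.one_div_pos_of_nat fun x hx => hx.2.le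
  · intro V hV
    obtain ⟨R, hR⟩ := hV.2.1.subset_ball x₀
    obtain ⟨r, hr, hdist⟩ := hV.exists_le_infEDist_compl
    obtain ⟨n, hnR, hnr⟩ := ((tendsto_natCast_atTop_atTop.eventually_ge_atTop R).and
      ((tendsto_one_div_add_atTop_nhds_zero_nat (𝕜 := ℝ)).eventually_lt_const hr)).exists
    exact ⟨n, fun x hx => ⟨Metric.ball_subset_ball hnR (hR hx),
      ((ENNReal.ofReal_lt_ofReal_iff hr).2 hnr).trans_le (hdist x hx)⟩⟩

lemma WellInside.image_fst {Y Z : Type*} [PseudoMetricSpace Y] [PseudoMetricSpace Z]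
    {K : Set (Y × Z)} {A : Set Y} {B : Set Z} (hK : WellInside K (A ×ˢ B)) :
    WellInside (Prod.fst '' K) A := by
  obtain ⟨hsub, hb, r, hr, hdist⟩ := hK
  refine ⟨?_, hb.image_fst, r, hr, ?_⟩
  · rintro _ ⟨z, hz, rfl⟩
    exact (hsub hz).1
  · rintro _ ⟨z, hz, rfl⟩ y hy
    simpa [Prod.dist_eq] using hdist z hz (y, z.2) fun h => hy h.1

lemma WellInside.image_snd {Y Z : Type*} [PseudoMetricSpace Y] [PseudoMetricSpace Z]
    {K : Set (Y × Z)} {A : Set Y} {B : Set Z} (hK : WellInside K (A ×ˢ B)) :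
    WellInside (Prod.snd '' K) B := by
  obtain ⟨hsub, hb, r, hr, hdist⟩ := hK
  refine ⟨?_, hb.image_snd, r, hr, ?_⟩
  · rintro _ ⟨z, hz, rfl⟩
    exact (hsub hz).2
  · rintro _ ⟨z, hz, rfl⟩ y hy
    simpa [Prod.dist_eq] using hdist z hz (z.1, y) fun h => hy h.2

lemma WellInside.exists_subset_Icc {A : Set ℝ} {τ : ℝ} (hA : WellInside A (Ioo 0 τ)) :
    ∃ a b, 0 < a ∧ b < τ ∧ A ⊆ Icc a b := by
  obtain ⟨hsub, -, r, hr, hdist⟩ := hA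
  refine ⟨r, τ - r, hr, by linarith, fun t ht => ?_⟩
  obtain ⟨ht0, htτ⟩ := hsub ht
  have h0 := hdist t ht 0 (by simp)
  have hτ := hdist t ht τ (by simp)
  rw [Real.dist_eq, sub_zero, abs_of_pos ht0] at h0
  rw [Real.dist_eq, abs_of_neg (by linarith)] at hτ
  exact ⟨h0, by linarith⟩

lemma WellInside.exists_subset_prod {τ : ℝ} {K : Set (X × ℝ)}
    (hK : WellInside K (Ω ×ˢ Ioo 0 τ)) :
    ∃ (U : Set X) (a b : ℝ), IsOpen U ∧ WellInside U Ω ∧ 0 < a ∧ b < τ ∧ K ⊆ U ×ˢ Icc a b := by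
  obtain ⟨U, hU⟩ := exists_isExhaustion Ω
  obtain ⟨n, hn⟩ := hU.cofinal _ hK.image_fst
  obtain ⟨a, b, ha, hb, hab⟩ := hK.image_snd.exists_subset_Icc
  exact ⟨U n, a, b, hU.isOpen n, hU.wellInside n, ha, hb, fun z hz =>
    ⟨hn (mem_image_of_mem _ hz), hab (mem_image_of_mem _ hz)⟩⟩

variable [MeasurableSpace X] [BorelSpace X] {p : ℝ} {μ : Measure X}

lemma IsExhaustion.isMinWeakUpperGradientLoc_iSup (hp : 0 < p) {U : ℕ → Set X}
    (hU : IsExhaustion Ω U) {u : X → ℝ} {g : ℕ → X → ℝ≥0∞}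
    (hg : ∀ n, IsMinWeakUpperGradient p μ (U n) u (g n)) :
    IsMinWeakUpperGradientLoc p μ Ω u (fun x => ⨆ n, (U n).indicator (g n) x) := by
  intro V hV hVΩ
  have hUm (m : ℕ) : MeasurableSet (U m) := (hU.isOpen m).measurableSet
  obtain ⟨n, hn⟩ := hU.cofinal V hVΩ
  refine IsMinWeakUpperGradient.mono_set hp (hUm n) hV hn ((hg n).congr_ae hp ?_ ?_)
  · exact .iSup fun m => (hg m).1.1.indicator (hUm m)
  have hagree (m : ℕ) : ∀ᵐ x ∂(μ.restrict (U n)), x ∈ U m → g m x = g n x := by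
    rcases le_total m n with hmn | hmn
    · have := (hg m).ae_eq ((hg n).mono_set hp (hUm n) (hU.isOpen m) (hU.mono hmn))
      exact ae_restrict_of_ae ((ae_restrict_iff' (hUm m)).1 this)
    · have := ((hg m).mono_set hp (hUm m) (hU.isOpen n) (hU.mono hmn)).ae_eq (hg n)
      filter_upwards [this] with x hx _ using hx
  filter_upwards [ae_all_iff.2 hagree, ae_restrict_mem (hUm n)] with x hx hxn
  refine le_antisymm (iSup_le fun m => indicator_apply_le' (fun hm => (hx m hm).le)
    fun _ => zero_le) ?_
  exact (indicator_of_mem hxn _).ge.trans (le_iSup (fun m => (U m).indicator (g m) x) n)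

end exhaustion

section series

lemma eLpNorm_ofReal_rpow_eq_lintegral {Y ε : Type*} [MeasurableSpace Y] [ENorm ε] {p : ℝ}
    (hp : 0 < p) (f : Y → ε) (ν : Measure Y) :
    eLpNorm f (ENNReal.ofReal p) ν ^ p = ∫⁻ x, ‖f x‖ₑ ^ p ∂ν := by
  rw [eLpNorm_eq_lintegral_rpow_enorm_toReal (by simpa using hp) ENNReal.ofReal_ne_top,
    ENNReal.toReal_ofReal hp.le, ← ENNReal.rpow_mul, one_div_mul_cancel hp.ne', ENNReal.rpow_one]

lemma eLpNorm_tsum_le {Y : Type*} [MeasurableSpace Y] {ν : Measure Y} {p : ℝ} (hp : 1 ≤ p)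
    {g : ℕ → Y → ℝ≥0∞} (hg : ∀ n, AEMeasurable (g n) ν) :
    eLpNorm (fun x => ∑' n, g n x) (ENNReal.ofReal p) ν ≤
      ∑' n, eLpNorm (g n) (ENNReal.ofReal p) ν := by
  have hp0 : 0 < p := zero_lt_one.trans_le hp
  have hpow (x : Y) : (∑' n, g n x) ^ p = ⨆ n, (∑ i ∈ Finset.range n, g i x) ^ p := by
    rw [ENNReal.tsum_eq_iSup_nat]
    exact (ENNReal.orderIsoRpow p hp0).map_iSup _
  refine (ENNReal.rpow_le_rpow_iff hp0).1 ?_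
  simp only [eLpNorm_ofReal_rpow_eq_lintegral hp0, enorm_eq_self, hpow]
  rw [lintegral_iSup' (fun n => (Finset.aemeasurable_fun_sum _ fun i _ => hg i).pow_const p)
    (ae_of_all _ fun x m n hmn => ENNReal.rpow_le_rpow (Finset.sum_le_sum_of_subset
      (Finset.range_mono hmn)) hp0.le)]
  refine iSup_le fun n => ?_
  calc ∫⁻ x, (∑ i ∈ Finset.range n, g i x) ^ p ∂ν
      = eLpNorm (∑ i ∈ Finset.range n, g i) (ENNReal.ofReal p) ν ^ p := by
        simp only [eLpNorm_ofReal_rpow_eq_lintegral hp0, enorm_eq_self, Finset.sum_apply]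
    _ ≤ (∑' n, eLpNorm (g n) (ENNReal.ofReal p) ν) ^ p := by
        gcongr
        exact (eLpNorm_sum_le (fun i _ => (hg i).aestronglyMeasurable) (by simpa using hp)).trans
          (ENNReal.sum_le_tsum _)

lemma eLpNorm_tsum_le_of_ae_summable {Y : Type*} [MeasurableSpace Y] {ν : Measure Y} {p : ℝ}
    (hp : 1 ≤ p) {w : ℕ → Y → ℝ} {v : Y → ℝ} (hw : ∀ k, AEStronglyMeasurable (w k) ν)
    (hsummable : ∀ᵐ x ∂ν, Summable fun k => w k x)
    (hv : ∀ x, (Summable fun k => w k x) → v x = ∑' k, w k x) :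
    eLpNorm v (ENNReal.ofReal p) ν ≤ ∑' k, eLpNorm (w k) (ENNReal.ofReal p) ν := by
  calc eLpNorm v (ENNReal.ofReal p) ν
      ≤ eLpNorm (fun x => ∑' k, ‖w k x‖ₑ) (ENNReal.ofReal p) ν := by
        refine eLpNorm_mono_enorm_ae ?_
        filter_upwards [hsummable] with x hx
        rw [hv x hx]
        exact enorm_tsum_le_tsum_enorm
    _ ≤ ∑' k, eLpNorm (fun x => ‖w k x‖ₑ) (ENNReal.ofReal p) ν :=
        eLpNorm_tsum_le hp fun k => (hw k).enorm
    _ = ∑' k, eLpNorm (w k) (ENNReal.ofReal p) ν := by simp only [eLpNorm_enorm]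

variable {X : Type*} [MetricSpace X] [MeasurableSpace X] {p : ℝ} {μ : Measure X} {U V : Set X}
  {u v : X → ℝ}

lemma MemNewton.mono_set (hVU : V ⊆ U) (hu : MemNewton p μ U u) : MemNewton p μ V u := by
  obtain ⟨huLp, g, hg, hgfin⟩ := hu
  exact ⟨huLp.mono_measure (Measure.restrict_mono hVU le_rfl), g, hg.mono_set hVU,
    (lintegral_mono_set hVU).trans_lt hgfin⟩

lemma MemNewton.sub (hp : 1 ≤ p) (hu : MemNewton p μ U u) (hv : MemNewton p μ U v) :
    MemNewton p μ U (u - v) := by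
  simpa [sub_eq_add_neg] using hu.add hp (hv.smul hp (-1))

lemma gradNorm_mono_set (hVU : V ⊆ U) (u : X → ℝ) : gradNorm p μ V u ≤ gradNorm p μ U u :=
  le_iInf₂ fun g hg => (iInf₂_le g (hg.mono_set hVU)).trans
    (eLpNorm_mono_measure _ (Measure.restrict_mono hVU le_rfl))

lemma newtonENorm_mono_set (hp : 0 < p) (hVU : V ⊆ U) (u : X → ℝ) :
    newtonENorm p μ V u ≤ newtonENorm p μ U u := by
  unfold newtonENorm
  gcongr
  exact gradNorm_mono_set hVU u

lemma eLpNorm_le_newtonENorm (hp : 0 < p) (u : X → ℝ) :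
    eLpNorm u (ENNReal.ofReal p) (μ.restrict U) ≤ newtonENorm p μ U u := by
  rw [newtonENorm, one_div, ENNReal.le_rpow_inv_iff hp]
  exact le_self_add

lemma gradNorm_le_newtonENorm (hp : 0 < p) (u : X → ℝ) :
    gradNorm p μ U u ≤ newtonENorm p μ U u := by
  rw [newtonENorm, one_div, ENNReal.le_rpow_inv_iff hp]
  exact le_add_self

lemma newtonENorm_le_add (hp : 1 ≤ p) (u : X → ℝ) : newtonENorm p μ U u ≤
    eLpNorm u (ENNReal.ofReal p) (μ.restrict U) + gradNorm p μ U u := by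
  rw [newtonENorm, one_div, ENNReal.rpow_inv_le_iff (zero_lt_one.trans_le hp)]
  exact ENNReal.add_rpow_le_rpow_add _ _ hp

lemma IsWeakUpperGradient.aeCurve_enorm_sub_le (hp : 0 < p) (hU : MeasurableSet U) {g : X → ℝ≥0∞}
    (hg : IsWeakUpperGradient p μ U u g) :
    AECurve p μ U (fun γ => ∀ s ∈ Icc (0 : ℝ) 1, ∀ t ∈ Icc (0 : ℝ) 1,
      ‖u (γ s) - u (γ t)‖ₑ ≤ curveIntegral g γ) := by
  refine (hg.aeCurve_le_lintegral_Icc hp hU subset_rfl).mono fun γ hγ hle => ?_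
  have hle' {s t : ℝ} (hs : s ∈ Icc (0 : ℝ) 1) (ht : t ∈ Icc (0 : ℝ) 1) (hst : s ≤ t) :
      ‖u (γ t) - u (γ s)‖ₑ ≤ curveIntegral g γ := by
    rw [Real.enorm_eq_ofReal_abs]
    exact (hle s t hs.1 hst ht.2 fun r hr => hγ.2 r ⟨hs.1.trans hr.1, hr.2.trans ht.2⟩).trans
      (lintegral_mono_set (Icc_subset_Icc hs.1 ht.2))
  intro s hs t ht
  rcases le_total s t with hst | hts
  · rw [enorm_sub_rev]
    exact hle' hs ht hst
  · exact hle' ht hs hts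

variable [BorelSpace X]

lemma tsum_curveIntegral {g : ℕ → X → ℝ≥0∞} (hg : ∀ k, Measurable (g k)) {γ : ℝ → X}
    (hγ : IsACCurve U γ) :
    ∑' k, curveIntegral (g k) γ = curveIntegral (fun x => ∑' k, g k x) γ := by
  unfold curveIntegral
  rw [← lintegral_tsum fun k => hγ.aemeasurable_mul_metricSpeed (hg k)]
  simp only [ENNReal.tsum_mul_right]

/- Along almost every nonconstant curve the series converges absolutely at one point, and its
increments are dominated by the convergent series of the path integrals. -/
lemma aeCurve_summable (hp : 0 < p) (hU : MeasurableSet U) {w : ℕ → X → ℝ} {g : ℕ → X → ℝ≥0∞}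
    (hg : ∀ k, IsWeakUpperGradient p μ U (w k) (g k))
    (hgfin : ∫⁻ x in U, (∑' k, g k x) ^ p ∂μ < ∞)
    (hw : ∀ᵐ x ∂(μ.restrict U), Summable fun k => w k x) :
    AECurve p μ U (fun γ => γ 1 ≠ γ 0 → ∀ s ∈ Icc (0 : ℝ) 1, Summable fun k => w k (γ s)) := by
  set E := toMeasurable (μ.restrict U) {x | ¬ Summable fun k => w k x}
  have hE : μ.restrict U E = 0 := (measure_toMeasurable _).trans hw
  refine (((aeCurve_forall hp fun k => (hg k).aeCurve_enorm_sub_le hp hU).and hp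
    (aeCurve_curveIntegral_ne_top hp (.tsum fun k => (hg k).1) hgfin)).and hp
    (aeCurve_exists_notMem hp (measurableSet_toMeasurable _ _) hE)).mono ?_
  rintro γ hγ ⟨⟨hsub, hfin⟩, hnotMem⟩ hne s hs
  obtain ⟨t, ht, htE⟩ := hnotMem hne
  have hwt : Summable fun k => w k (γ t) := by
    by_contra hnot
    exact htE (subset_toMeasurable _ _ hnot)
  have hdiff : Summable fun k => w k (γ s) - w k (γ t) := by
    refine .of_enorm (ne_top_of_le_ne_top hfin ?_)
    rw [← tsum_curveIntegral (fun k => (hg k).1) hγ]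
    exact ENNReal.tsum_le_tsum fun k => hsub k s hs t ht
  simpa using hdiff.add hwt

lemma isWeakUpperGradient_tsum (hp : 0 < p) (hU : MeasurableSet U) {w : ℕ → X → ℝ}
    {g : ℕ → X → ℝ≥0∞} (hg : ∀ k, IsWeakUpperGradient p μ U (w k) (g k))
    (hgfin : ∫⁻ x in U, (∑' k, g k x) ^ p ∂μ < ∞)
    (hw : ∀ᵐ x ∂(μ.restrict U), Summable fun k => w k x)
    (hv : ∀ x, (Summable fun k => w k x) → v x = ∑' k, w k x) :
    IsWeakUpperGradient p μ U v (fun x => ∑' k, g k x) := by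
  refine ⟨.tsum fun k => (hg k).1, ((aeCurve_forall hp fun k => (hg k).aeCurve).and hp
    (aeCurve_summable hp hU hg hgfin hw)).mono ?_⟩
  rintro γ hγ ⟨hle, hsummable⟩
  by_cases hne : γ 1 = γ 0
  · simp [hne]
  have h0 := hsummable hne 0 (by simp)
  have h1 := hsummable hne 1 (by simp)
  rw [hv _ h0, hv _ h1, ← h1.tsum_sub h0, ← tsum_curveIntegral (fun k => (hg k).1) hγ,
    ← Real.enorm_eq_ofReal_abs]
  refine enorm_tsum_le_tsum_enorm.trans (ENNReal.tsum_le_tsum fun k => ?_)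
  rw [Real.enorm_eq_ofReal_abs]
  exact hle k

lemma memNewton_tsum (hp : 1 ≤ p) (hU : IsOpen U) {w : ℕ → X → ℝ}
    (hw : ∀ k, MemNewton p μ U (w k)) (hsum : ∑' k, newtonENorm p μ U (w k) ≠ ∞)
    (hv : ∀ x, (Summable fun k => w k x) → v x = ∑' k, w k x) :
    MemNewton p μ U v ∧ newtonENorm p μ U v ≤ 2 * ∑' k, newtonENorm p μ U (w k) := by
  have hp0 : 0 < p := zero_lt_one.trans_le hp
  choose g hg using fun k => exists_isMinWeakUpperGradient hp0 hU (hw k).2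
  have hgrad : eLpNorm (fun x => ∑' k, g k x) (ENNReal.ofReal p) (μ.restrict U) ≤
      ∑' k, newtonENorm p μ U (w k) :=
    (eLpNorm_tsum_le hp fun k => (hg k).1.1.aemeasurable).trans <| ENNReal.tsum_le_tsum fun k =>
      ((hg k).eLpNorm_eq hp).trans_le (gradNorm_le_newtonENorm hp0 _)
  have hLp_sum : ∑' k, eLpNorm (w k) (ENNReal.ofReal p) (μ.restrict U) ≤
      ∑' k, newtonENorm p μ U (w k) :=
    ENNReal.tsum_le_tsum fun k => eLpNorm_le_newtonENorm hp0 _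
  have hsummable : ∀ᵐ x ∂(μ.restrict U), Summable fun k => w k x :=
    (summable_norm_of_tsum_eLpNorm_ne_top (by simpa using hp) (fun k => (hw k).1.1)
      (ne_top_of_le_ne_top hsum hLp_sum)).mono fun x hx => hx.of_norm
  have hLp := (eLpNorm_tsum_le_of_ae_summable hp (fun k => (hw k).1.1) hsummable hv).trans hLp_sum
  have hgfin := (eLpNorm_lt_top_iff_lintegral hp _).1 (hgrad.trans_lt hsum.lt_top)
  have hvg := isWeakUpperGradient_tsum hp0 hU.measurableSet (fun k => (hg k).1) hgfin hsummable hv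
  have hmeas : AEStronglyMeasurable v (μ.restrict U) := by
    refine aestronglyMeasurable_of_tendsto_ae atTop
      (fun n => Finset.aestronglyMeasurable_sum (Finset.range n) fun k _ => (hw k).1.1) ?_
    filter_upwards [hsummable] with x hx
    simpa [hv x hx] using hx.hasSum.tendsto_sum_nat
  refine ⟨⟨⟨hmeas, hLp.trans_lt hsum.lt_top⟩, _, hvg, hgfin⟩, (newtonENorm_le_add hp v).trans ?_⟩
  rw [two_mul]
  exact add_le_add hLp ((iInf₂_le _ hvg).trans hgrad)

lemma tsum_nat_add_sub_of_summable {a : ℕ → ℝ} {m : ℕ}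
    (h : Summable fun k => a (k + m + 1) - a (k + m)) :
    a 0 + ∑' k, (a (k + 1) - a k) - a m = ∑' k, (a (k + m + 1) - a (k + m)) := by
  have hsum : Summable fun k => a (k + 1) - a k := (summable_nat_add_iff m).1 h
  rw [← hsum.sum_add_tsum_nat_add m, Finset.sum_range_sub]
  ring

lemma exists_newton_limit (hp : 1 ≤ p) {U : ℕ → Set X} (hUo : ∀ n, IsOpen (U n)) (hU : Monotone U)
    {u : ℕ → X → ℝ} (hu : ∀ n, MemNewton p μ (U n) (u n)) {c : ℕ → ℝ≥0∞} (hc : ∑' n, c n ≠ ∞)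
    (hle : ∀ n, newtonENorm p μ (U n) (u (n + 1) - u n) ≤ c n) :
    ∃ v : X → ℝ, ∀ n m, n ≤ m → MemNewton p μ (U n) v ∧
      newtonENorm p μ (U n) (v - u m) ≤ 2 * ∑' k, c (k + m) := by
  obtain ⟨v, hv⟩ : ∃ v : X → ℝ, ∀ x, v x = u 0 x + ∑' k, (u (k + 1) x - u k x) :=
    ⟨_, fun _ => rfl⟩
  refine ⟨v, fun n m hnm => ?_⟩
  have hsub (k : ℕ) : U n ⊆ U (k + m) := hU (hnm.trans (Nat.le_add_left m k))
  have hum (k : ℕ) : MemNewton p μ (U n) (u (k + m)) := (hu (k + m)).mono_set (hsub k)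
  have hw (k : ℕ) : MemNewton p μ (U n) (u (k + m + 1) - u (k + m)) := by
    have hnext := hum (k + 1)
    rw [add_right_comm] at hnext
    exact hnext.sub hp (hum k)
  have hwle : ∑' k, newtonENorm p μ (U n) (u (k + m + 1) - u (k + m)) ≤ ∑' k, c (k + m) :=
    ENNReal.tsum_le_tsum fun k =>
      (newtonENorm_mono_set (zero_lt_one.trans_le hp) (hsub k) _).trans (hle (k + m))
  have hctail : ∑' k, c (k + m) ≠ ∞ := ne_top_of_le_ne_top hc
    (ENNReal.tsum_comp_le_tsum_of_injective (add_left_injective m) c)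
  have hvm (x : X) (hx : Summable fun k => (u (k + m + 1) - u (k + m)) x) :
      (v - u m) x = ∑' k, (u (k + m + 1) - u (k + m)) x := by
    rw [Pi.sub_apply, hv]
    exact tsum_nat_add_sub_of_summable (a := fun k => u k x) hx
  obtain ⟨hmem, hnorm⟩ :=
    memNewton_tsum hp (hUo n) hw (ne_top_of_le_ne_top hctail hwle) hvm
  refine ⟨?_, hnorm.trans (by gcongr)⟩
  have hadd := hmem.add hp ((hu m).mono_set (hU hnm))
  rwa [sub_add_cancel] at hadd

end series

section newtonSpace

variable {X : Type*} [MetricSpace X] [MeasurableSpace X] {p : ℝ} [hp : Fact (1 ≤ p)]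
  {μ : Measure X} {U V : Set X} {u v : X → ℝ}

/-- The element of `Ñ^{1,p}(U)` given by a function. -/
def PreNewton.of (u : X → ℝ) (hu : MemNewton p μ U u) : PreNewton p μ U :=
  (⟨u, hu⟩ : ↥(preNewtonSubmodule p μ U))

/-- The function underlying an element of `Ñ^{1,p}(U)`. -/
def PreNewton.fn (u : PreNewton p μ U) : X → ℝ :=
  Subtype.val (p := fun v => v ∈ preNewtonSubmodule p μ U) u

lemma PreNewton.memNewton (u : PreNewton p μ U) : MemNewton p μ U u.fn :=
  Subtype.property (p := fun v => v ∈ preNewtonSubmodule p μ U) u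

lemma PreNewton.fn_of (hu : MemNewton p μ U u) : (PreNewton.of u hu).fn = u := rfl

lemma PreNewton.norm_def (u : PreNewton p μ U) : ‖u‖ = (newtonENorm p μ U u.fn).toReal := rfl

lemma PreNewton.enorm_def (u : PreNewton p μ U) : ‖u‖ₑ = newtonENorm p μ U u.fn := by
  rw [← ofReal_norm, norm_def, ENNReal.ofReal_toReal (u.memNewton.newtonENorm_ne_top hp.out)]

lemma PreNewton.edist_def (u v : PreNewton p μ U) :
    edist u v = newtonENorm p μ U (u.fn - v.fn) := by
  rw [edist_eq_enorm_sub, enorm_def]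
  rfl

lemma toNewton_of_mem (hu : MemNewton p μ U u) :
    toNewton p μ U u = SeparationQuotient.mk (PreNewton.of u hu) := dif_pos hu

lemma enorm_toNewton (hu : MemNewton p μ U u) : ‖toNewton p μ U u‖ₑ = newtonENorm p μ U u := by
  rw [toNewton_of_mem hu, ← ofReal_norm, SeparationQuotient.norm_mk, ofReal_norm,
    PreNewton.enorm_def]
  rfl

lemma toNewton_sub (hu : MemNewton p μ U u) (hv : MemNewton p μ U v) :
    toNewton p μ U (u - v) = toNewton p μ U u - toNewton p μ U v := by
  rw [toNewton_of_mem hu, toNewton_of_mem hv, toNewton_of_mem (hu.sub hp.out hv)]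
  rfl

lemma enorm_toNewton_sub (hu : MemNewton p μ U u) (hv : MemNewton p μ U v) :
    ‖toNewton p μ U u - toNewton p μ U v‖ₑ = newtonENorm p μ U (u - v) := by
  rw [← toNewton_sub hu hv, enorm_toNewton (hu.sub hp.out hv)]

lemma exists_toNewton_eq (w : Newton p μ U) : ∃ u, MemNewton p μ U u ∧ toNewton p μ U u = w := by
  obtain ⟨u, rfl⟩ := SeparationQuotient.surjective_mk w
  exact ⟨u.fn, u.memNewton, toNewton_of_mem u.memNewton⟩

lemma toNewton_eq_of_newtonENorm_sub_eq_zero (hu : MemNewton p μ U u) (hv : MemNewton p μ U v)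
    (h : newtonENorm p μ U (u - v) = 0) : toNewton p μ U u = toNewton p μ U v := by
  rw [← sub_eq_zero, ← enorm_eq_zero, enorm_toNewton_sub hu hv, h]

/-- The restriction from `Ñ^{1,p}(U)` to `Ñ^{1,p}(V)`, `V ⊆ U`, as a linear map. -/
def preNewtonRestrictₗ (hVU : V ⊆ U) : PreNewton p μ U →ₗ[ℝ] PreNewton p μ V where
  toFun u := PreNewton.of u.fn (u.memNewton.mono_set hVU)
  map_add' _ _ := rfl
  map_smul' _ _ := rfl

lemma preNewtonRestrictₗ_apply (hVU : V ⊆ U) (u : PreNewton p μ U) :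
    preNewtonRestrictₗ hVU u = PreNewton.of u.fn (u.memNewton.mono_set hVU) := rfl

lemma norm_preNewtonRestrictₗ_le (hVU : V ⊆ U) (u : PreNewton p μ U) :
    ‖preNewtonRestrictₗ hVU u‖ ≤ 1 * ‖u‖ := by
  rw [one_mul, PreNewton.norm_def, PreNewton.norm_def, preNewtonRestrictₗ_apply,
    PreNewton.fn_of]
  exact ENNReal.toReal_mono (u.memNewton.newtonENorm_ne_top hp.out)
    (newtonENorm_mono_set (zero_lt_one.trans_le hp.out) hVU u.fn)

/-- The restriction from `Ñ^{1,p}(U)` to `Ñ^{1,p}(V)`, `V ⊆ U`, as a continuous linear map. -/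
def preNewtonRestrict (hVU : V ⊆ U) : PreNewton p μ U →L[ℝ] PreNewton p μ V :=
  (preNewtonRestrictₗ hVU).mkContinuous 1 (norm_preNewtonRestrictₗ_le hVU)

/-- The restriction from `N^{1,p}(U)` to `N^{1,p}(V)`, `V ⊆ U`. -/
def newtonRestrict (hVU : V ⊆ U) : Newton p μ U →L[ℝ] Newton p μ V :=
  SeparationQuotient.liftCLM ((SeparationQuotient.mkCLM ℝ (PreNewton p μ V)).comp
    (preNewtonRestrict hVU)) fun _ _ h => SeparationQuotient.mk_eq_mk.2
      (h.map (preNewtonRestrict hVU).continuous)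

lemma newtonRestrict_toNewton (hVU : V ⊆ U) (hu : MemNewton p μ U u) :
    newtonRestrict hVU (toNewton p μ U u) = toNewton p μ V u := by
  rw [toNewton_of_mem hu, toNewton_of_mem (hu.mono_set hVU)]
  rfl

variable [BorelSpace X]

lemma completeSpace_newton (hU : IsOpen U) : CompleteSpace (Newton p μ U) := by
  rw [SeparationQuotient.completeSpace_iff]
  obtain ⟨c, hc0, hc⟩ := ENNReal.exists_pos_sum_of_countable one_ne_zero ℕ
  refine EMetric.complete_of_convergent_controlled_sequences (fun n => (c n : ℝ≥0∞))
    (fun n => by exact_mod_cast hc0 n) fun u hu => ?_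
  have hle (n : ℕ) : newtonENorm p μ U ((u (n + 1)).fn - (u n).fn) ≤ c n := by
    rw [← PreNewton.edist_def]
    exact (hu n (n + 1) n n.le_succ le_rfl).le
  obtain ⟨v, hv⟩ := exists_newton_limit hp.out (fun _ => hU) (fun _ _ _ => le_rfl)
    (fun n => (u n).memNewton) hc.ne_top hle
  refine ⟨PreNewton.of v (hv 0 0 le_rfl).1, tendsto_iff_edist_tendsto_0.2 ?_⟩
  have hlim : Tendsto (fun m => 2 * ∑' k, (c (k + m) : ℝ≥0∞)) atTop (𝓝 0) := by
    simpa using ENNReal.Tendsto.const_mul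
      (ENNReal.tendsto_sum_nat_add (fun n => (c n : ℝ≥0∞)) hc.ne_top) (.inr ENNReal.ofNat_ne_top)
  refine tendsto_of_tendsto_of_tendsto_of_le_of_le tendsto_const_nhds hlim (fun _ => bot_le)
    fun m => ?_
  rw [edist_comm, PreNewton.edist_def]
  exact (hv 0 m m.zero_le).2

lemma IsExhaustion.exists_memNewtonLoc {Ω : Set X} {U : ℕ → Set X} (hU : IsExhaustion Ω U)
    (w : ∀ n, Newton p μ (U n))
    (hw : ∀ n, newtonRestrict (hU.mono n.le_succ) (w (n + 1)) = w n) :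
    ∃ v, MemNewtonLoc p μ Ω v ∧ ∀ n, toNewton p μ (U n) v = w n := by
  choose u hu huw using fun n => exists_toNewton_eq (w n)
  have hle (n : ℕ) : newtonENorm p μ (U n) (u (n + 1) - u n) ≤ 0 := by
    have hu' := (hu (n + 1)).mono_set (hU.mono n.le_succ)
    rw [← enorm_toNewton_sub hu' (hu n),
      ← newtonRestrict_toNewton (hU.mono n.le_succ) (hu (n + 1)), huw, huw, hw]
    simp
  obtain ⟨v, hv⟩ := exists_newton_limit hp.out hU.isOpen hU.mono hu (c := fun _ => 0) (by simp) hle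
  refine ⟨v, fun V _ hVΩ => ?_, fun n => ?_⟩
  · obtain ⟨n, hn⟩ := hU.cofinal V hVΩ
    exact (hv n n le_rfl).1.mono_set hn
  · rw [← huw n]
    refine toNewton_eq_of_newtonENorm_sub_eq_zero (hv n n le_rfl).1 (hu n) ?_
    simpa using (hv n n le_rfl).2

end newtonSpace

section timeDependent

lemma exists_measurable_countable_approx {E T : Type*} [NormedAddCommGroup E] [MeasurableSpace T]
    {H : T → E} (hH : StronglyMeasurable H) {ε : ℕ → ℝ≥0∞} (hε : ∀ j, 0 < ε j) :
    ∃ (c : ℕ → E) (N : ℕ → T → ℕ), (∀ j, Measurable (N j)) ∧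
      ∀ j t, ‖H t - c (N j t)‖ₑ < ε j := by
  classical
  obtain ⟨C, hC, hHC⟩ := hH.isSeparable_range
  obtain ⟨c, hc⟩ := (hC.insert (0 : E)).exists_eq_range (insert_nonempty _ _)
  have hdense (j : ℕ) (t : T) : ∃ i, ‖H t - c i‖ₑ < ε j := by
    have hclosure : H t ∈ closure (range c) := by
      rw [← hc]
      exact closure_mono (subset_insert _ _) (hHC (mem_range_self t))
    obtain ⟨_, ⟨i, rfl⟩, hi⟩ := EMetric.mem_closure_iff.1 hclosure (ε j) (hε j)
    exact ⟨i, by rwa [← edist_eq_enorm_sub]⟩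
  refine ⟨c, fun j t => Nat.find (hdense j t), fun j => ?_, fun j t => Nat.find_spec (hdense j t)⟩
  exact measurable_find (hdense j) fun i =>
    measurableSet_lt (hH.sub stronglyMeasurable_const).enorm measurable_const

variable {X : Type*} [MetricSpace X] [MeasurableSpace X] {p : ℝ} {μ : Measure X} {U : Set X}

lemma ae_tendsto_isMinWeakUpperGradient [BorelSpace X] (hp : 1 ≤ p) (hU : IsOpen U) {u : X → ℝ}
    {v : ℕ → X → ℝ} {g : X → ℝ≥0∞} (hg : IsMinWeakUpperGradient p μ U u g) {h : ℕ → X → ℝ≥0∞}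
    (hh : ∀ j, IsMinWeakUpperGradient p μ U (v j) (h j))
    (hsum : ∑' j, gradNorm p μ U (u - v j) ≠ ∞) :
    ∀ᵐ x ∂(μ.restrict U), Tendsto (fun j => h j x) atTop (𝓝 (g x)) := by
  have hp0 : 0 < p := zero_lt_one.trans_le hp
  choose k hk using fun j => exists_isMinWeakUpperGradient hp0 hU <|
    (gradNorm_lt_top_iff hp _).1 (ENNReal.ne_top_of_tsum_ne_top hsum j).lt_top
  have hk' (j : ℕ) : IsMinWeakUpperGradient p μ U (v j - u) (k j) := by simpa using (hk j).neg
  have hkm (j : ℕ) : AEMeasurable (k j) (μ.restrict U) := (hk j).1.1.aemeasurable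
  have hksum : eLpNorm (fun x => ∑' j, k j x) (ENNReal.ofReal p) (μ.restrict U) < ∞ := by
    refine ((eLpNorm_tsum_le hp hkm).trans (le_of_eq ?_)).trans_lt hsum.lt_top
    exact tsum_congr fun j => (hk j).eLpNorm_eq hp
  have hk_lt := ae_lt_top' ((AEMeasurable.tsum hkm).pow_const p)
    ((eLpNorm_lt_top_iff_lintegral hp _).1 hksum).ne
  have hg_lt := ae_lt_top' (hg.1.1.aemeasurable.pow_const p) hg.2.1.ne
  filter_upwards [hk_lt, hg_lt, ae_all_iff.2 fun j => hg.ae_le_add hp (hh j) (hk j),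
    ae_all_iff.2 fun j => (hh j).ae_le_add hp hg (hk' j)] with x hkx hgx hle hge
  rw [ENNReal.rpow_lt_top_iff_of_pos hp0] at hkx hgx
  have hk0 : Tendsto (fun j => k j x) atTop (𝓝 0) :=
    ENNReal.tendsto_atTop_zero_of_tsum_ne_top hkx.ne
  have hlower : Tendsto (fun j => g x - k j x) atTop (𝓝 (g x)) := by
    simpa using ENNReal.Tendsto.sub (tendsto_const_nhds (x := g x)) hk0 (.inl hgx.ne)
  have hupper : Tendsto (fun j => g x + k j x) atTop (𝓝 (g x)) := by
    simpa using (tendsto_const_nhds (x := g x)).add hk0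
  exact tendsto_of_tendsto_of_tendsto_of_le_of_le hlower hupper
    (fun j => tsub_le_iff_right.2 (hle j)) hge

variable [hp : Fact (1 ≤ p)]

/- Joint measurability is clear for maps with countably many values, which approximate with
summable errors, so that the minimal weak upper gradients converge almost everywhere. -/
lemma exists_measurable_isMinWeakUpperGradient [BorelSpace X] {T : Type*} [MeasurableSpace T]
    {ν : Measure T} (hU : IsOpen U) {h : T → X → ℝ} (hmem : ∀ᵐ t ∂ν, MemNewton p μ U (h t))
    (hmeas : AEStronglyMeasurable (fun t => toNewton p μ U (h t)) ν) :
    ∃ G : X × T → ℝ≥0∞, Measurable G ∧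
      ∀ᵐ t ∂ν, IsMinWeakUpperGradient p μ U (h t) (fun x => G (x, t)) := by
  have hp0 : 0 < p := zero_lt_one.trans_le hp.out
  obtain ⟨H, hHmeas, hHeq⟩ := hmeas
  obtain ⟨ε, hε, hεsum⟩ := ENNReal.exists_pos_sum_of_countable one_ne_zero ℕ
  obtain ⟨c, N, hNmeas, hN⟩ := exists_measurable_countable_approx hHmeas
    (ε := fun j => (ε j : ℝ≥0∞)) fun j => by exact_mod_cast hε j
  choose D hD hDc using fun i => exists_toNewton_eq (c i)
  choose g hg using fun i => exists_isMinWeakUpperGradient hp0 hU (hD i).2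
  have hGmeas (j : ℕ) : Measurable (fun y : X × T => g (N j y.2) y.1) :=
    (measurable_from_prod_countable_right fun i => (hg i).1.1 :
      Measurable fun z : ℕ × X => g z.1 z.2).comp
        (((hNmeas j).comp measurable_snd).prodMk measurable_fst)
  refine ⟨fun y => limsup (fun j => g (N j y.2) y.1) atTop, .limsup hGmeas, ?_⟩
  filter_upwards [hmem, hHeq] with t ht hHt
  obtain ⟨g₀, hg₀⟩ := exists_isMinWeakUpperGradient hp0 hU ht.2
  have hsum : ∑' j, gradNorm p μ U (h t - D (N j t)) ≠ ∞ := by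
    refine ne_top_of_le_ne_top hεsum.ne_top (ENNReal.tsum_le_tsum fun j => ?_)
    refine (gradNorm_le_newtonENorm hp0 _).trans ?_
    rw [← enorm_toNewton_sub ht (hD _), hDc, hHt]
    exact (hN j t).le
  refine hg₀.congr_ae hp0 (.limsup fun j => (hg (N j t)).1.1) ?_
  filter_upwards [ae_tendsto_isMinWeakUpperGradient hp.out hU hg₀ (fun j => hg (N j t)) hsum]
    with x hx using hx.limsup_eq

variable {Ω : Set X}

lemma MemNewtonLoc.sub {u v : X → ℝ} (hu : MemNewtonLoc p μ Ω u) (hv : MemNewtonLoc p μ Ω v) :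
    MemNewtonLoc p μ Ω (u - v) := fun U hU hUΩ => (hu U hU hUΩ).sub hp.out (hv U hU hUΩ)

/-- A family of functions, parametrized by a measure space, that is a strongly measurable map into
`N^{1,p}_loc(Ω)`, up to a null set of parameters. Measurability is required in `N^{1,p}(U)` for each
open `U ⋐ Ω`, as `N^{1,p}_loc(Ω)` itself is not given a topology. -/
structure AEStronglyMeasurableNewtonLoc {T : Type*} [MeasurableSpace T] (p : ℝ) [Fact (1 ≤ p)]
    (μ : Measure X) (Ω : Set X) (ν : Measure T) (h : T → X → ℝ) : Prop where
  ae_memNewtonLoc : ∀ᵐ t ∂ν, MemNewtonLoc p μ Ω (h t)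
  aestronglyMeasurable : ∀ U, IsOpen U → WellInside U Ω →
    AEStronglyMeasurable (fun t => toNewton p μ U (h t)) ν

namespace AEStronglyMeasurableNewtonLoc

variable {T T' : Type*} [MeasurableSpace T] [MeasurableSpace T'] {ν ν' : Measure T}
  {h k : T → X → ℝ}

lemma sub (hh : AEStronglyMeasurableNewtonLoc p μ Ω ν h)
    (hk : AEStronglyMeasurableNewtonLoc p μ Ω ν k) :
    AEStronglyMeasurableNewtonLoc p μ Ω ν (fun t => h t - k t) where
  ae_memNewtonLoc := by
    filter_upwards [hh.ae_memNewtonLoc, hk.ae_memNewtonLoc] with t hht hkt using hht.sub hkt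
  aestronglyMeasurable U hU hUΩ := by
    refine ((hh.aestronglyMeasurable U hU hUΩ).sub (hk.aestronglyMeasurable U hU hUΩ)).congr ?_
    filter_upwards [hh.ae_memNewtonLoc, hk.ae_memNewtonLoc] with t hht hkt
    exact (toNewton_sub (hht U hU hUΩ) (hkt U hU hUΩ)).symm

lemma mono_measure (hh : AEStronglyMeasurableNewtonLoc p μ Ω ν h) (hν : ν' ≤ ν) :
    AEStronglyMeasurableNewtonLoc p μ Ω ν' h where
  ae_memNewtonLoc := ae_mono hν hh.ae_memNewtonLoc
  aestronglyMeasurable U hU hUΩ := (hh.aestronglyMeasurable U hU hUΩ).mono_measure hν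

lemma comp_measurePreserving {ν' : Measure T'} {σ : T' → T}
    (hh : AEStronglyMeasurableNewtonLoc p μ Ω ν h) (hσ : MeasurePreserving σ ν' ν) :
    AEStronglyMeasurableNewtonLoc p μ Ω ν' (fun t => h (σ t)) where
  ae_memNewtonLoc := hσ.quasiMeasurePreserving.ae hh.ae_memNewtonLoc
  aestronglyMeasurable U hU hUΩ :=
    (hh.aestronglyMeasurable U hU hUΩ).comp_measurePreserving hσ

lemma exists_isParabolicMinUpperGradient [BorelSpace X] {J : Set ℝ} {h : ℝ → X → ℝ}
    (hh : AEStronglyMeasurableNewtonLoc p μ Ω (volume.restrict J) h) :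
    ∃ G : X × ℝ → ℝ≥0∞, IsParabolicMinUpperGradient p μ Ω J h G := by
  obtain ⟨U, hU⟩ := exists_isExhaustion Ω
  choose G hGmeas hG using fun n =>
    exists_measurable_isMinWeakUpperGradient (hU.isOpen n)
      (hh.ae_memNewtonLoc.mono fun t ht => ht _ (hU.isOpen n) (hU.wellInside n))
      (hh.aestronglyMeasurable _ (hU.isOpen n) (hU.wellInside n))
  refine ⟨fun y => ⨆ n, (Prod.fst ⁻¹' U n).indicator (G n) y, .iSup fun n =>
    (hGmeas n).indicator (measurable_fst (hU.isOpen n).measurableSet), ?_⟩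
  filter_upwards [ae_all_iff.2 hG] with t ht
  exact hU.isMinWeakUpperGradientLoc_iSup (zero_lt_one.trans_le hp.out) ht

end AEStronglyMeasurableNewtonLoc

end timeDependent

section bochner

variable {E : Type*} [NormedAddCommGroup E] {p : ℝ}

lemma tendsto_eLpNorm_comp_sub_sub {q : ℝ≥0∞} [Fact (1 ≤ q)] (hq : q ≠ ∞) {φ : ℝ → E}
    (hφ : MemLp φ q volume) :
    Tendsto (fun s => eLpNorm (fun t => φ (t - s) - φ t) q volume) (𝓝 0) (𝓝 0) := by
  let σ (s : ℝ) : C(ℝ, ℝ) := ⟨fun t => t - s, by fun_prop⟩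
  have hσ : Continuous σ := ContinuousMap.continuous_of_continuous_uncurry _ <| by
    simp only [Function.uncurry_def, σ, ContinuousMap.coe_mk]
    fun_prop
  have hσm (s : ℝ) : MeasurePreserving (σ s) volume volume := measurePreserving_sub_right volume s
  have hcont := (continuous_const (y := hφ.toLp φ)).compMeasurePreservingLp hσ hσm hq
  refine (tendsto_iff_edist_tendsto_0.1 (hcont.tendsto 0)).congr fun s => ?_
  rw [Lp.toLp_compMeasurePreserving hφ (hσm s), Lp.toLp_compMeasurePreserving hφ (hσm 0),
    Lp.edist_toLp_toLp]
  congr with t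
  simp [σ]

variable [NormedSpace ℝ E]

lemma eLpNorm_integral_le_of_forall_eLpNorm_le {S T : Type*} [MeasurableSpace S]
    [MeasurableSpace T] {ν : Measure S} [IsProbabilityMeasure ν] {ρ : Measure T} [SFinite ρ]
    (hp : 1 ≤ p) {Φ : T → S → E} (hΦ : StronglyMeasurable (Function.uncurry Φ)) {δ : ℝ≥0∞}
    (hδ : ∀ᵐ s ∂ν, eLpNorm (fun t => Φ t s) (ENNReal.ofReal p) ρ ≤ δ) :
    eLpNorm (fun t => ∫ s, Φ t s ∂ν) (ENNReal.ofReal p) ρ ≤ δ := by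
  have hp0 : 0 < p := zero_lt_one.trans_le hp
  have hjensen (t : T) : ‖∫ s, Φ t s ∂ν‖ₑ ^ p ≤ ∫⁻ s, ‖Φ t s‖ₑ ^ p ∂ν := by
    rw [← eLpNorm_ofReal_rpow_eq_lintegral hp0]
    gcongr
    calc ‖∫ s, Φ t s ∂ν‖ₑ ≤ eLpNorm (Φ t) 1 ν := by
          rw [eLpNorm_one_eq_lintegral_enorm]
          exact enorm_integral_le_lintegral_enorm _
      _ ≤ eLpNorm (Φ t) (ENNReal.ofReal p) ν :=
          eLpNorm_le_eLpNorm_of_exponent_le (by simpa using hp)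
            (hΦ.comp_measurable measurable_prodMk_left).aestronglyMeasurable
  rw [← ENNReal.rpow_le_rpow_iff hp0, eLpNorm_ofReal_rpow_eq_lintegral hp0]
  calc ∫⁻ t, ‖∫ s, Φ t s ∂ν‖ₑ ^ p ∂ρ ≤ ∫⁻ t, ∫⁻ s, ‖Φ t s‖ₑ ^ p ∂ν ∂ρ := lintegral_mono hjensen
    _ = ∫⁻ s, ∫⁻ t, ‖Φ t s‖ₑ ^ p ∂ρ ∂ν :=
        lintegral_lintegral_swap (hΦ.enorm.pow_const p).aemeasurable
    _ ≤ ∫⁻ _, δ ^ p ∂ν := by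
        refine lintegral_mono_ae (hδ.mono fun s hs => ?_)
        rw [← eLpNorm_ofReal_rpow_eq_lintegral hp0]
        gcongr
    _ = δ ^ p := by simp

lemma intervalIntegrable_smul_comp_sub {q : ℝ≥0∞} (hq : 1 ≤ q) {φ : ℝ → E}
    (hφ : MemLp φ q volume) {w : ℝ → ℝ} (hw : Continuous w) (t a b : ℝ) :
    IntervalIntegrable (fun s => w s • φ (t - s)) volume a b := by
  have hloc : LocallyIntegrable (fun s => φ (t - s)) volume :=
    (hφ.comp_measurePreserving (Measure.measurePreserving_sub_left volume t)).locallyIntegrable hq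
  exact (hloc.integrableOn_isCompact isCompact_uIcc).intervalIntegrable.continuousOn_smul
    hw.continuousOn

lemma stronglyMeasurable_intervalIntegral_smul_comp_sub {φ : ℝ → E} (hφ : StronglyMeasurable φ)
    {w : ℝ → ℝ} (hw : Measurable w) (a b : ℝ) :
    StronglyMeasurable (fun t => ∫ s in a..b, w s • φ (t - s)) := by
  have h : StronglyMeasurable (fun z : ℝ × ℝ => w z.2 • φ (z.1 - z.2)) :=
    (hw.comp measurable_snd).stronglyMeasurable.smul
      (hφ.comp_measurable (measurable_fst.sub measurable_snd))
  exact h.integral_prod_right'.sub h.integral_prod_right'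

variable [CompleteSpace E]

lemma eLpNorm_intervalIntegral_smul_comp_sub_sub_le (hp : 1 ≤ p) {φ : ℝ → E}
    (hφm : StronglyMeasurable φ) (hφ : MemLp φ (ENNReal.ofReal p) volume) {w : ℝ → ℝ}
    (hw : Continuous w) (hw0 : ∀ s, 0 ≤ w s) {a b : ℝ} (hab : a ≤ b) (hw1 : ∫ s in a..b, w s = 1)
    {δ : ℝ≥0∞}
    (hδ : ∀ s ∈ Ioc a b, eLpNorm (fun t => φ (t - s) - φ t) (ENNReal.ofReal p) volume ≤ δ) :
    eLpNorm (fun t => (∫ s in a..b, w s • φ (t - s)) - φ t) (ENNReal.ofReal p) volume ≤ δ := by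
  let ν := (volume.restrict (Ioc a b)).withDensity fun s => ENNReal.ofReal (w s)
  have hν : IsProbabilityMeasure ν := ⟨by
    rw [withDensity_apply _ .univ, Measure.restrict_univ,
      ← ofReal_integral_eq_lintegral_ofReal (hw.integrableOn_Icc.mono_set Ioc_subset_Icc_self)
        (ae_of_all _ hw0), ← intervalIntegral.integral_of_le hab, hw1, ENNReal.ofReal_one]⟩
  have hmean (t : ℝ) :
      (∫ s in a..b, w s • φ (t - s)) - φ t = ∫ s, (φ (t - s) - φ t) ∂ν := by
    have hconst : ∫ s in a..b, w s • φ t = φ t := by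
      rw [intervalIntegral.integral_smul_const, hw1, one_smul]
    nth_rw 1 [← hconst]
    rw [← intervalIntegral.integral_sub
        (intervalIntegrable_smul_comp_sub (by simpa using hp) hφ hw t a b)
        (Continuous.intervalIntegrable (by fun_prop) a b),
      intervalIntegral.integral_of_le hab,
      integral_withDensity_eq_integral_toReal_smul hw.measurable.ennreal_ofReal
        (ae_of_all _ fun _ => ENNReal.ofReal_lt_top)]
    simp only [ENNReal.toReal_ofReal (hw0 _), smul_sub]
  simp only [hmean]
  have hφsub : StronglyMeasurable (Function.uncurry fun t s : ℝ => φ (t - s) - φ t) :=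
    (hφm.comp_measurable (measurable_fst.sub measurable_snd)).sub
      (hφm.comp_measurable measurable_fst)
  refine eLpNorm_integral_le_of_forall_eLpNorm_le hp hφsub ?_
  have hac : ν ≪ volume.restrict (Ioc a b) := withDensity_absolutelyContinuous _ _
  filter_upwards [hac.ae_le (ae_restrict_mem measurableSet_Ioc)] with s hs using hδ s hs

variable {η : ℝ → ℝ}

lemma IsMollifier.integral_rescale (hη : IsMollifier η) {ε : ℝ} (hε : 0 < ε) :
    ∫ s in (-ε)..ε, ε⁻¹ * η (s / ε) = 1 := by
  rw [intervalIntegral.integral_const_mul, intervalIntegral.integral_comp_div _ hε.ne', neg_div,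
    div_self hε.ne', smul_eq_mul, inv_mul_cancel_left₀ hε.ne',
    intervalIntegral.integral_of_le (by norm_num), ← integral_Icc_eq_integral_Ioc,
    setIntegral_eq_integral_of_forall_compl_eq_zero, hη.integral_eq_one]
  exact fun x hx => Function.notMem_support.1 fun hx' => hx (hη.support (subset_tsupport _ hx'))

lemma IsMollifier.continuous_rescale (hη : IsMollifier η) (ε : ℝ) :
    Continuous (fun s => ε⁻¹ * η (s / ε)) := by
  have := hη.smooth.continuous
  fun_prop

lemma IsMollifier.rescale_nonneg (hη : IsMollifier η) {ε : ℝ} (hε : 0 < ε) (s : ℝ) :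
    0 ≤ ε⁻¹ * η (s / ε) := mul_nonneg (inv_nonneg.2 hε.le) (hη.nonneg _)

lemma IsMollifier.tendsto_eLpNorm_intervalIntegral_sub (hη : IsMollifier η) (hp : 1 ≤ p)
    {φ : ℝ → E} (hφm : StronglyMeasurable φ) (hφ : MemLp φ (ENNReal.ofReal p) volume) :
    Tendsto (fun ε : ℝ => eLpNorm
      (fun t => (∫ s in (-ε)..ε, (ε⁻¹ * η (s / ε)) • φ (t - s)) - φ t) (ENNReal.ofReal p) volume)
      (𝓝[>] 0) (𝓝 0) := by
  have : Fact (1 ≤ ENNReal.ofReal p) := ⟨by simpa using hp⟩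
  rw [ENNReal.tendsto_nhds_zero]
  intro δ hδ
  have htranslation := ENNReal.tendsto_nhds_zero.1
    (tendsto_eLpNorm_comp_sub_sub ENNReal.ofReal_ne_top hφ) δ hδ
  obtain ⟨r, hr, hball⟩ := Metric.eventually_nhds_iff.1 htranslation
  filter_upwards [Ioo_mem_nhdsGT hr] with ε hε
  refine eLpNorm_intervalIntegral_smul_comp_sub_sub_le hp hφm hφ (hη.continuous_rescale ε)
    (hη.rescale_nonneg hε.1) (by linarith [hε.1]) (hη.integral_rescale hε.1) fun s hs => hball ?_
  rw [Real.dist_0_eq_abs]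
  exact (abs_le.2 ⟨hs.1.le, hs.2⟩).trans_lt hε.2

end bochner

section times

lemma ae_comp_sub_left {P : ℝ → Prop} (h : ∀ᵐ t, P t) (t : ℝ) : ∀ᵐ s, P (t - s) :=
  (Measure.measurePreserving_sub_left volume t).quasiMeasurePreserving.ae h

lemma ae_comp_sub_right {P : ℝ → Prop} (h : ∀ᵐ t, P t) (s : ℝ) : ∀ᵐ t, P (t - s) :=
  (measurePreserving_sub_right volume s).quasiMeasurePreserving.ae h

lemma aestronglyMeasurable_restrict_Ioo_of_Icc {E : Type*} [TopologicalSpace E]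
    [TopologicalSpace.PseudoMetrizableSpace E] {φ : ℝ → E} {c d : ℝ}
    (h : ∀ a b, c < a → b < d → AEStronglyMeasurable φ (volume.restrict (Icc a b))) :
    AEStronglyMeasurable φ (volume.restrict (Ioo c d)) := by
  obtain ⟨a, -, ha, hac⟩ := exists_seq_strictAnti_tendsto c
  obtain ⟨b, -, hb, hbd⟩ := exists_seq_strictMono_tendsto d
  exact (aecover_Ioo_of_Icc hac hbd).aestronglyMeasurable fun n =>
    (h _ _ (ha n) (hb n)).mono_measure
      (Measure.restrict_mono_measure Measure.restrict_le_self _)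

end times

section parabolic

variable {X : Type*} [MetricSpace X] [MeasurableSpace X] {p : ℝ} [hp : Fact (1 ≤ p)]
  {μ : Measure X} {Ω U V : Set X} {τ : ℝ} {f : ℝ → X → ℝ}

lemma IsParabolicMinUpperGradient.eLpNorm_le [SFinite μ] {J : Set ℝ} {h : ℝ → X → ℝ}
    {G : X × ℝ → ℝ≥0∞} (hG : IsParabolicMinUpperGradient p μ Ω J h G) (hU : IsOpen U)
    (hUΩ : WellInside U Ω) {I : Set ℝ} (hIJ : I ⊆ J) {K : Set (X × ℝ)} (hK : K ⊆ U ×ˢ I) :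
    eLpNorm G (ENNReal.ofReal p) ((μ.prod volume).restrict K) ≤
      eLpNorm (fun t => newtonENorm p μ U (h t)) (ENNReal.ofReal p) (volume.restrict I) := by
  have hp0 : 0 < p := zero_lt_one.trans_le hp.out
  have hslice : ∀ᵐ t ∂(volume.restrict I),
      ∫⁻ x in U, G (x, t) ^ p ∂μ ≤ newtonENorm p μ U (h t) ^ p := by
    filter_upwards [ae_restrict_of_ae_restrict_of_subset hIJ hG.2] with t ht
    calc ∫⁻ x in U, G (x, t) ^ p ∂μ
        = eLpNorm (fun x => G (x, t)) (ENNReal.ofReal p) (μ.restrict U) ^ p := by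
          simp only [eLpNorm_ofReal_rpow_eq_lintegral hp0, enorm_eq_self]
      _ = gradNorm p μ U (h t) ^ p := by rw [(ht U hU hUΩ).eLpNorm_eq hp.out]
      _ ≤ newtonENorm p μ U (h t) ^ p := by
          gcongr
          exact gradNorm_le_newtonENorm hp0 _
  refine (eLpNorm_mono_measure _ (Measure.restrict_mono hK le_rfl)).trans ?_
  rw [← ENNReal.rpow_le_rpow_iff hp0, eLpNorm_ofReal_rpow_eq_lintegral hp0,
    eLpNorm_ofReal_rpow_eq_lintegral hp0, ← Measure.prod_restrict,
    lintegral_prod_symm' _ (hG.1.enorm.pow_const p)]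
  exact lintegral_mono_ae hslice

lemma IsParabolicMinUpperGradient.eLpNorm_le_of_newtonENorm_le [SFinite μ] {J : Set ℝ}
    {h : ℝ → X → ℝ} {G : X × ℝ → ℝ≥0∞} (hG : IsParabolicMinUpperGradient p μ Ω J h G)
    (hU : IsOpen U) (hUΩ : WellInside U Ω) {I : Set ℝ} (hI : MeasurableSet I) (hIJ : I ⊆ J)
    {K : Set (X × ℝ)} (hK : K ⊆ U ×ˢ I) {E : Type*} [NormedAddCommGroup E] {Φ : ℝ → E}
    (hΦ : ∀ᵐ t, t ∈ I → newtonENorm p μ U (h t) ≤ ‖Φ t‖ₑ) :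
    eLpNorm G (ENNReal.ofReal p) ((μ.prod volume).restrict K) ≤
      eLpNorm Φ (ENNReal.ofReal p) volume :=
  calc _ ≤ eLpNorm (fun t => newtonENorm p μ U (h t)) (ENNReal.ofReal p) (volume.restrict I) :=
        hG.eLpNorm_le hU hUΩ hIJ hK
    _ ≤ eLpNorm Φ (ENNReal.ofReal p) (volume.restrict I) :=
        eLpNorm_mono_enorm_ae ((ae_restrict_iff' hI).2 hΦ)
    _ ≤ _ := eLpNorm_mono_measure _ Measure.restrict_le_self

lemma MemParabolicLoc.ae_memNewtonLoc (hf : MemParabolicLoc p μ Ω τ f) :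
    ∀ᵐ t, t ∈ Ioo 0 τ → MemNewtonLoc p μ Ω (f t) :=
  (ae_restrict_iff' measurableSet_Ioo).1 hf.1

lemma MemParabolicLoc.aestronglyMeasurableNewtonLoc (hf : MemParabolicLoc p μ Ω τ f) :
    AEStronglyMeasurableNewtonLoc p μ Ω (volume.restrict (Ioo 0 τ)) f where
  ae_memNewtonLoc := hf.1
  aestronglyMeasurable U hU hUΩ :=
    aestronglyMeasurable_restrict_Ioo_of_Icc fun a b ha hb => (hf.2 U hU hUΩ a b ha hb).1

lemma MemParabolicLoc.exists_memLp_eq_toNewton (hf : MemParabolicLoc p μ Ω τ f) (hU : IsOpen U)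
    (hUΩ : WellInside U Ω) {a b : ℝ} (ha : 0 < a) (hb : b < τ) :
    ∃ ψ : ℝ → Newton p μ U, StronglyMeasurable ψ ∧ MemLp ψ (ENNReal.ofReal p) volume ∧
      ∀ᵐ t, t ∈ Icc a b → ψ t = toNewton p μ U (f t) := by
  have hfab := hf.2 U hU hUΩ a b ha hb
  refine ⟨(Icc a b).indicator (hfab.1.mk _),
    hfab.1.stronglyMeasurable_mk.indicator measurableSet_Icc, ?_, ?_⟩
  · rw [memLp_indicator_iff_restrict measurableSet_Icc]
    exact (memLp_congr_ae hfab.1.ae_eq_mk).1 hfab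
  · filter_upwards [(ae_restrict_iff' measurableSet_Icc).1 hfab.1.ae_eq_mk] with t ht htab
    rw [indicator_of_mem htab, ht htab]

lemma ae_smul_comp_sub_eq {E : Type*} [SMul ℝ E] {φ ψ : ℝ → E} {a b t ε : ℝ}
    (hψ : ∀ᵐ t, t ∈ Icc a b → ψ t = φ t) (w : ℝ → ℝ) (hε : 0 < ε)
    (ha : a ≤ t - ε) (hb : t + ε ≤ b) :
    ∀ᵐ s, s ∈ uIoc (-ε) ε → w s • φ (t - s) = w s • ψ (t - s) := by
  filter_upwards [ae_comp_sub_left hψ t] with s hψs hs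
  rw [uIoc_of_le (by linarith)] at hs
  rw [hψs ⟨by linarith [hs.2], by linarith [hs.1]⟩]

lemma MemParabolicLoc.intervalIntegrable (hf : MemParabolicLoc p μ Ω τ f) (hU : IsOpen U)
    (hUΩ : WellInside U Ω) {w : ℝ → ℝ} (hw : Continuous w) {ε t : ℝ} (hε : 0 < ε)
    (ht : t ∈ Ioo ε (τ - ε)) :
    IntervalIntegrable (fun s => w s • toNewton p μ U (f (t - s))) volume (-ε) ε := by
  obtain ⟨ψ, -, hψ, hψf⟩ := hf.exists_memLp_eq_toNewton hU hUΩ (a := t - ε) (b := t + ε)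
    (by linarith [ht.1]) (by linarith [ht.2])
  refine (intervalIntegrable_smul_comp_sub (by simpa using hp.out) hψ hw t (-ε) ε).congr_ae ?_
  rw [EventuallyEq, ae_restrict_iff' measurableSet_uIoc]
  filter_upwards [ae_smul_comp_sub_eq hψf w hε le_rfl le_rfl] with s hψs hs using (hψs hs).symm

lemma MemParabolicLoc.newtonRestrict_intervalIntegral [BorelSpace X]
    (hf : MemParabolicLoc p μ Ω τ f) (hU : IsOpen U) (hUΩ : WellInside U Ω) (hV : IsOpen V)
    (hVU : V ⊆ U) {w : ℝ → ℝ} (hw : Continuous w) {ε t : ℝ} (hε : 0 < ε)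
    (ht : t ∈ Ioo ε (τ - ε)) :
    newtonRestrict hVU (∫ s in (-ε)..ε, w s • toNewton p μ U (f (t - s))) =
      ∫ s in (-ε)..ε, w s • toNewton p μ V (f (t - s)) := by
  have := completeSpace_newton (p := p) (μ := μ) hU
  have := completeSpace_newton (p := p) (μ := μ) hV
  rw [← ContinuousLinearMap.intervalIntegral_comp_comm _
    (hf.intervalIntegrable hU hUΩ hw hε ht)]
  refine intervalIntegral.integral_congr_ae ?_
  filter_upwards [ae_comp_sub_left hf.ae_memNewtonLoc t] with s hfs hs
  rw [uIoc_of_le (by linarith)] at hs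
  have hmem := hfs ⟨by linarith [hs.2, ht.1], by linarith [hs.1, ht.2]⟩ U hU hUΩ
  rw [map_smul, newtonRestrict_toNewton hVU hmem]

variable {η : ℝ → ℝ} {ε : ℝ}

lemma MemParabolicLoc.exists_isTimeMollification [BorelSpace X] (hf : MemParabolicLoc p μ Ω τ f)
    (hη : IsMollifier η) (hε : 0 < ε) : ∃ F, IsTimeMollification p μ Ω τ η ε f F := by
  obtain ⟨U, hU⟩ := exists_isExhaustion Ω
  have hw := hη.continuous_rescale ε
  have hslice (t : ℝ) : ∃ v : X → ℝ, t ∈ Ioo ε (τ - ε) → MemNewtonLoc p μ Ω v ∧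
      ∀ V : Set X, IsOpen V → WellInside V Ω → toNewton p μ V v =
        ∫ s in (-ε)..ε, (ε⁻¹ * η (s / ε)) • toNewton p μ V (f (t - s)) := by
    by_cases ht : t ∈ Ioo ε (τ - ε)
    swap
    · exact ⟨0, fun h => absurd h ht⟩
    obtain ⟨v, hv, hvU⟩ := hU.exists_memNewtonLoc
      (fun n => ∫ s in (-ε)..ε, (ε⁻¹ * η (s / ε)) • toNewton p μ (U n) (f (t - s)))
      fun n => hf.newtonRestrict_intervalIntegral (hU.isOpen _) (hU.wellInside _) (hU.isOpen n)
        (hU.mono n.le_succ) hw hε ht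
    refine ⟨v, fun _ => ⟨hv, fun V hV hVΩ => ?_⟩⟩
    obtain ⟨n, hn⟩ := hU.cofinal V hVΩ
    rw [← newtonRestrict_toNewton hn (hv _ (hU.isOpen n) (hU.wellInside n)), hvU,
      hf.newtonRestrict_intervalIntegral (hU.isOpen n) (hU.wellInside n) hV hn hw hε ht]
  choose F hF using hslice
  exact ⟨F, hF⟩

namespace IsTimeMollification

variable {F : ℝ → X → ℝ}

lemma toNewton_eq (hF : IsTimeMollification p μ Ω τ η ε f F) (hε : 0 < ε) (hU : IsOpen U)
    (hUΩ : WellInside U Ω) {a b t : ℝ} {ψ : ℝ → Newton p μ U}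
    (hψ : ∀ᵐ t, t ∈ Icc a b → ψ t = toNewton p μ U (f t)) (ht : t ∈ Ioo ε (τ - ε))
    (ha : a ≤ t - ε) (hb : t + ε ≤ b) :
    toNewton p μ U (F t) = ∫ s in (-ε)..ε, (ε⁻¹ * η (s / ε)) • ψ (t - s) := by
  rw [(hF t ht).2 U hU hUΩ]
  exact intervalIntegral.integral_congr_ae
    (ae_smul_comp_sub_eq hψ (fun s => ε⁻¹ * η (s / ε)) hε ha hb)

lemma aestronglyMeasurableNewtonLoc (hF : IsTimeMollification p μ Ω τ η ε f F)
    (hf : MemParabolicLoc p μ Ω τ f) (hη : IsMollifier η) (hε : 0 < ε) :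
    AEStronglyMeasurableNewtonLoc p μ Ω (volume.restrict (Ioo ε (τ - ε))) F where
  ae_memNewtonLoc := (ae_restrict_iff' measurableSet_Ioo).2 (ae_of_all _ fun t ht => (hF t ht).1)
  aestronglyMeasurable U hU hUΩ := by
    refine aestronglyMeasurable_restrict_Ioo_of_Icc fun a b ha hb => ?_
    obtain ⟨ψ, hψm, -, hψf⟩ := hf.exists_memLp_eq_toNewton hU hUΩ (a := a - ε) (b := b + ε)
      (by linarith) (by linarith)
    refine ⟨_, stronglyMeasurable_intervalIntegral_smul_comp_sub hψm
      (hη.continuous_rescale ε).measurable (-ε) ε,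
      (ae_restrict_iff' measurableSet_Icc).2 (ae_of_all _ fun t ht => ?_)⟩
    exact hF.toNewton_eq hε hU hUΩ hψf ⟨ha.trans_le ht.1, ht.2.trans_lt hb⟩
      (by linarith [ht.1]) (by linarith [ht.2])

lemma exists_isParabolicMinUpperGradient_sub [BorelSpace X]
    (hF : IsTimeMollification p μ Ω τ η ε f F) (hf : MemParabolicLoc p μ Ω τ f)
    (hη : IsMollifier η) (hε : 0 < ε) :
    ∃ G, IsParabolicMinUpperGradient p μ Ω (Ioo ε (τ - ε)) (fun t => F t - f t) G := by
  have hsub : Ioo ε (τ - ε) ⊆ Ioo 0 τ := Ioo_subset_Ioo hε.le (by linarith)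
  exact ((hF.aestronglyMeasurableNewtonLoc hf hη hε).sub
    (hf.aestronglyMeasurableNewtonLoc.mono_measure
      (Measure.restrict_mono hsub le_rfl))).exists_isParabolicMinUpperGradient

end IsTimeMollification

namespace MemParabolicLoc

lemma exists_isParabolicMinUpperGradient_translation_sub [BorelSpace X]
    (hf : MemParabolicLoc p μ Ω τ f) (s : ℝ) :
    ∃ G, IsParabolicMinUpperGradient p μ Ω (Ioo 0 τ ∩ Ioo s (τ + s))
      (fun t => f (t - s) - f t) G := by
  have htranslation : MeasurePreserving (fun t => t - s) (volume.restrict (Ioo s (τ + s)))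
      (volume.restrict (Ioo 0 τ)) := by
    simpa using (measurePreserving_sub_right volume s).restrict_preimage
      (measurableSet_Ioo (a := (0 : ℝ)) (b := τ))
  have hfs := hf.aestronglyMeasurableNewtonLoc.comp_measurePreserving htranslation
  exact ((hfs.mono_measure (Measure.restrict_mono inter_subset_right le_rfl)).sub
    (hf.aestronglyMeasurableNewtonLoc.mono_measure
      (Measure.restrict_mono inter_subset_left le_rfl))).exists_isParabolicMinUpperGradient

variable [SFinite μ] {K : Set (X × ℝ)}

lemma tendsto_eLpNorm_mollification_sub [BorelSpace X] (hf : MemParabolicLoc p μ Ω τ f)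
    (hη : IsMollifier η) {F : ℝ → ℝ → X → ℝ}
    (hF : ∀ ε > 0, IsTimeMollification p μ Ω τ η ε f (F ε)) {G : ℝ → X × ℝ → ℝ≥0∞}
    (hG : ∀ ε > 0, IsParabolicMinUpperGradient p μ Ω (Ioo ε (τ - ε)) (fun t => F ε t - f t) (G ε))
    (hK : WellInside K (Ω ×ˢ Ioo 0 τ)) :
    Tendsto (fun ε => eLpNorm (G ε) (ENNReal.ofReal p) ((μ.prod volume).restrict K))
      (𝓝[>] 0) (𝓝 0) := by
  obtain ⟨U, a, b, hU, hUΩ, ha, hb, hKU⟩ := hK.exists_subset_prod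
  have := completeSpace_newton (p := p) (μ := μ) hU
  obtain ⟨ψ, hψm, hψ, hψf⟩ := hf.exists_memLp_eq_toNewton hU hUΩ (a := a / 2)
    (b := (b + τ) / 2) (by linarith) (by linarith)
  refine tendsto_of_tendsto_of_tendsto_of_le_of_le' tendsto_const_nhds
    (hη.tendsto_eLpNorm_intervalIntegral_sub hp.out hψm hψ) (.of_forall fun _ => bot_le) ?_
  filter_upwards [Ioo_mem_nhdsGT (half_pos ha), Ioo_mem_nhdsGT (half_pos (sub_pos.2 hb))]
    with ε ⟨hε, hεa⟩ ⟨_, hεb⟩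
  have hsub : Icc a b ⊆ Ioo ε (τ - ε) := Icc_subset_Ioo (by linarith) (by linarith)
  refine (hG ε hε).eLpNorm_le_of_newtonENorm_le hU hUΩ measurableSet_Icc hsub hKU ?_
  filter_upwards [hψf, hf.ae_memNewtonLoc] with t htψ htf ht
  have hft := htf ⟨by linarith [ht.1], by linarith [ht.2]⟩ U hU hUΩ
  have hFt := (hF ε hε t (hsub ht)).1 U hU hUΩ
  rw [htψ ⟨by linarith [ht.1], by linarith [ht.2]⟩, ← (hF ε hε).toNewton_eq hε hU hUΩ hψf
    (hsub ht) (by linarith [ht.1]) (by linarith [ht.2]), enorm_toNewton_sub hFt hft]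

lemma tendsto_eLpNorm_translation_sub (hf : MemParabolicLoc p μ Ω τ f) {G : ℝ → X × ℝ → ℝ≥0∞}
    (hG : ∀ s, IsParabolicMinUpperGradient p μ Ω (Ioo 0 τ ∩ Ioo s (τ + s))
      (fun t => f (t - s) - f t) (G s))
    (hK : WellInside K (Ω ×ˢ Ioo 0 τ)) :
    Tendsto (fun s => eLpNorm (G s) (ENNReal.ofReal p) ((μ.prod volume).restrict K))
      (𝓝 0) (𝓝 0) := by
  have : Fact (1 ≤ ENNReal.ofReal p) := ⟨by simpa using hp.out⟩
  obtain ⟨U, a, b, hU, hUΩ, ha, hb, hKU⟩ := hK.exists_subset_prod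
  obtain ⟨ψ, -, hψ, hψf⟩ := hf.exists_memLp_eq_toNewton hU hUΩ (a := a / 2)
    (b := (b + τ) / 2) (by linarith) (by linarith)
  refine tendsto_of_tendsto_of_tendsto_of_le_of_le' tendsto_const_nhds
    (tendsto_eLpNorm_comp_sub_sub ENNReal.ofReal_ne_top hψ) (.of_forall fun _ => bot_le) ?_
  filter_upwards [Ioo_mem_nhds (neg_lt_zero.2 (half_pos (sub_pos.2 hb))) (half_pos ha)]
    with s ⟨hsb, hsa⟩
  have hsub : Icc a b ⊆ Ioo 0 τ ∩ Ioo s (τ + s) := subset_inter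
    (Icc_subset_Ioo ha hb) (Icc_subset_Ioo (by linarith) (by linarith))
  refine (hG s).eLpNorm_le_of_newtonENorm_le hU hUΩ measurableSet_Icc hsub hKU ?_
  filter_upwards [hψf, hf.ae_memNewtonLoc, ae_comp_sub_right hψf s,
    ae_comp_sub_right hf.ae_memNewtonLoc s] with t htψ htf htψs htfs ht
  have hft := htf (hsub ht).1 U hU hUΩ
  have hfts := htfs ⟨by linarith [ht.1], by linarith [ht.2]⟩ U hU hUΩ
  rw [htψ ⟨by linarith [ht.1], by linarith [ht.2]⟩,
    htψs ⟨by linarith [ht.1], by linarith [ht.2]⟩, enorm_toNewton_sub hfts hft]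

end MemParabolicLoc

end parabolic

end NewtonSobolev

end

theorem mainTheorem1_general {X : Type*} [MetricSpace X] [MeasurableSpace X] [BorelSpace X]
    (μ : MeasureTheory.Measure X) [MeasureTheory.SFinite μ] (Ω : Set X) (p : ℝ) [Fact (1 ≤ p)]
    (τ : ℝ)
    (η : ℝ → ℝ) (hη : NewtonSobolev.IsMollifier η)
    (f : ℝ → X → ℝ) (hf : NewtonSobolev.MemParabolicLoc p μ Ω τ f) :
    (∃ F : ℝ → ℝ → X → ℝ, ∀ ε > 0, NewtonSobolev.IsTimeMollification p μ Ω τ η ε f (F ε)) ∧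
    (∀ F : ℝ → ℝ → X → ℝ,
      (∀ ε > 0, NewtonSobolev.IsTimeMollification p μ Ω τ η ε f (F ε)) →
      (∃ G : ℝ → X × ℝ → ℝ≥0∞, ∀ ε > 0,
        NewtonSobolev.IsParabolicMinUpperGradient p μ Ω (Ioo ε (τ - ε))
          (fun t => F ε t - f t) (G ε)) ∧
      ∀ G : ℝ → X × ℝ → ℝ≥0∞,
        (∀ ε > 0, NewtonSobolev.IsParabolicMinUpperGradient p μ Ω (Ioo ε (τ - ε))
          (fun t => F ε t - f t) (G ε)) →
        ∀ K : Set (X × ℝ), NewtonSobolev.WellInside K (Ω ×ˢ Ioo 0 τ) →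
          Tendsto (fun ε => eLpNorm (G ε) (ENNReal.ofReal p) ((μ.prod volume).restrict K))
            (𝓝[>] 0) (𝓝 0)) ∧
    (∃ G : ℝ → X × ℝ → ℝ≥0∞, ∀ s,
      NewtonSobolev.IsParabolicMinUpperGradient p μ Ω (Ioo 0 τ ∩ Ioo s (τ + s))
        (fun t => f (t - s) - f t) (G s)) ∧
    (∀ G : ℝ → X × ℝ → ℝ≥0∞,
      (∀ s, NewtonSobolev.IsParabolicMinUpperGradient p μ Ω (Ioo 0 τ ∩ Ioo s (τ + s))
        (fun t => f (t - s) - f t) (G s)) →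
      ∀ K : Set (X × ℝ), NewtonSobolev.WellInside K (Ω ×ˢ Ioo 0 τ) →
        ∀ δ : ℝ≥0∞, 0 < δ → ∃ σ : ℝ, 0 < σ ∧ ∀ s : ℝ, |s| < σ → ∀ J : Set ℝ,
          eLpNorm (G s) (ENNReal.ofReal p) ((μ.prod volume).restrict (K ∩ univ ×ˢ J)) ≤ δ) := by
  refine ⟨?_, fun F hF => ⟨?_, fun G hG K hK => ?_⟩, ?_, fun G hG K hK δ hδ => ?_⟩
  · choose! F hF using fun (ε : ℝ) (hε : 0 < ε) => hf.exists_isTimeMollification hη hε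
    exact ⟨F, hF⟩
  · choose! G hG using fun (ε : ℝ) (hε : 0 < ε) =>
      (hF ε hε).exists_isParabolicMinUpperGradient_sub hf hη hε
    exact ⟨G, hG⟩
  · exact hf.tendsto_eLpNorm_mollification_sub hη hF hG hK
  · choose G hG using hf.exists_isParabolicMinUpperGradient_translation_sub
    exact ⟨G, hG⟩
  · obtain ⟨σ, hσ, hball⟩ := Metric.eventually_nhds_iff.1
      (ENNReal.tendsto_nhds_zero.1 (hf.tendsto_eLpNorm_translation_sub hG hK) δ hδ)
    refine ⟨σ, hσ, fun s hs J => le_trans (eLpNorm_mono_measure _ ?_) (hball (by simpa using hs))⟩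
    exact Measure.restrict_mono inter_subset_left le_rfl

theorem mainTheorem1 {X : Type*} [MetricSpace X] [CompleteSpace X]
    [TopologicalSpace.SeparableSpace X] [MeasurableSpace X] [BorelSpace X]
    (μ : MeasureTheory.Measure X) [MeasureTheory.IsLocallyFiniteMeasure μ]
    (Ω : Set X) (hΩ : IsOpen Ω) (p : ℝ) [Fact (1 ≤ p)] (τ : ℝ) (hτ : 0 < τ)
    (η : ℝ → ℝ) (hη : NewtonSobolev.IsMollifier η)
    (f : ℝ → X → ℝ) (hf : NewtonSobolev.MemParabolicLoc p μ Ω τ f) :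
    -- the time mollifications `F ε` of `f` exist
    (∃ F : ℝ → ℝ → X → ℝ, ∀ ε > 0, NewtonSobolev.IsTimeMollification p μ Ω τ η ε f (F ε)) ∧
    -- the minimal upper gradients `G ε` of `F ε - f` exist and tend to `0` in `L^p_loc`
    (∀ F : ℝ → ℝ → X → ℝ,
      (∀ ε > 0, NewtonSobolev.IsTimeMollification p μ Ω τ η ε f (F ε)) →
      (∃ G : ℝ → X × ℝ → ℝ≥0∞, ∀ ε > 0,
        NewtonSobolev.IsParabolicMinUpperGradient p μ Ω (Ioo ε (τ - ε))
          (fun t => F ε t - f t) (G ε)) ∧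
      ∀ G : ℝ → X × ℝ → ℝ≥0∞,
        (∀ ε > 0, NewtonSobolev.IsParabolicMinUpperGradient p μ Ω (Ioo ε (τ - ε))
          (fun t => F ε t - f t) (G ε)) →
        ∀ K : Set (X × ℝ), NewtonSobolev.WellInside K (Ω ×ˢ Ioo 0 τ) →
          Tendsto (fun ε => eLpNorm (G ε) (ENNReal.ofReal p) ((μ.prod volume).restrict K))
            (𝓝[>] 0) (𝓝 0)) ∧
    -- the minimal upper gradients `G s` of `f(t - s) - f(t)` exist and tend to `0` in `L^p_loc`,
    -- uniformly with respect to the set `J` of times over which the norm is taken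
    (∃ G : ℝ → X × ℝ → ℝ≥0∞, ∀ s,
      NewtonSobolev.IsParabolicMinUpperGradient p μ Ω (Ioo 0 τ ∩ Ioo s (τ + s))
        (fun t => f (t - s) - f t) (G s)) ∧
    (∀ G : ℝ → X × ℝ → ℝ≥0∞,
      (∀ s, NewtonSobolev.IsParabolicMinUpperGradient p μ Ω (Ioo 0 τ ∩ Ioo s (τ + s))
        (fun t => f (t - s) - f t) (G s)) →
      ∀ K : Set (X × ℝ), NewtonSobolev.WellInside K (Ω ×ˢ Ioo 0 τ) →
        ∀ δ : ℝ≥0∞, 0 < δ → ∃ σ : ℝ, 0 < σ ∧ ∀ s : ℝ, |s| < σ → ∀ J : Set ℝ,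
          eLpNorm (G s) (ENNReal.ofReal p) ((μ.prod volume).restrict (K ∩ univ ×ˢ J)) ≤ δ) := by
  have : SecondCountableTopology X := UniformSpace.secondCountable_of_separable X
  exact mainTheorem1_general μ Ω p τ η hη f hf
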